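/- Let $S=\{-1,+1\}$, let $d\ge 1$ and let $S^{\mathbb Z^d}$ carry the product topology and its Borel $\sigma$-field; write $\|k\|=\sum_{i=1}^d|k_i|$ for $k\in\mathbb Z^d$. Let $\beta>0$ and let $K:\mathbb Z^d\to[0,\infty)$ be symmetric ($K(-k)=K(k)$) and of finite range (there is $R>0$ with $K(k)=0$ whenever $\|k\|>R$). Let $P$ be the probabilistic cellular automaton with spins $\pm1$, i.e. the Markov kernel on $S^{\mathbb Z^d}$ given by $$P(d\sigma\mid\eta)=\bigotimes_{k\in\mathbb Z^d}p_k(d\sigma_k\mid\eta),\qquad p_k(s\mid\eta)=\tfrac12\Big(1+s\tanh\Big(\beta\sum_{k'\in\mathbb Z^d}K(k'-k)\,\eta_{k'}\Big)\Big),\quad s\in S.$$ (For this class of dynamics, $K\ge0$ is the condition of attractivity.) For a probability measure $\nu$, $\nu P^{(n)}$ denotes the law at time $n$ of the chain started from $\nu$. The dynamics $P$ is called ergodic towards a probability measure $\mu$ if $\mu$ is its unique stationary probability measure and $\nu P^{(n)}\to\mu$ weakly as $n\to\infty$ for every probability measure $\nu$ on $S^{\mathbb Z^d}$; it is called ergodic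 if it is ergodic towards some $\mu$, and non-ergodic otherwise. Let $\varphi=(\varphi_A)_A$, indexed by the finite sets $A\subset\mathbb Z^d$, be the potential canonically associated with $P$: $$\varphi_{U_k}(\sigma)=-\log\cosh\Big(\beta\sum_{j}K(k-j)\,\sigma_j\Big),\qquad U_k=\{j:K(k-j)\ne0\},\quad k\in\mathbb Z^d,$$ and $\varphi_A=0$ if $A$ is none of the sets $U_k$. For finite $\Lambda\subset\mathbb Z^d$ and $\tau\in S^{\mathbb Z^d}$, let $\mu_\Lambda^\tau$ be the probability measure carried by the configurations $\sigma$ that are equal to $\tau$ off $\Lambda$, with $$\mu_\Lambda^\tau(\sigma)=\frac1{Z_\Lambda^\tau}\exp\Big(-\sum_{A:\,A\cap\Lambda\ne\emptyset}\varphi_A(\sigma)\Big).$$ Let $\mathcal G(\varphi)$ be the set of Gibbs measures, i.e. of the probability measures $\mu$ on $S^{\mathbb Z^d}$ such that, for every finite $\Lambda$, $\sigma\mapsto\mu_\Lambda^{\sigma}$ is a version of the conditional law under $\mu$ given the spins off $\Lambda$. 1. If there is a phase transition, i.e. $\mathcal G(\varphi)$ has more than one element, then $P$ is non-ergodic. 2.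 Otherwise $\mathcal G(\varphi)=\{\mu\}$ for some $\mu$, and $P$ is ergodic towards $\mu$. If moreover $\varphi$ satisfies the weak mixing condition: there are $C>0$ and $M>0$ such that for all integers $L\ge2$, with $B_L=\{k:\|k\|\le L\}$ and $\pm$ the constant configurations, $$\int\sigma_0\,d\mu_{B_L}^{+}-\int\sigma_0\,d\mu_{B_L}^{-}\le C e^{-ML},$$ then the convergence to $\mu$ is exponentially fast: there are $\lambda>0$ and $n_1$ such that for all $n\ge n_1$ and all functions $f:S^{\mathbb Z^d}\to\mathbb R$ that depend on finitely many spins, $$\sup_{\sigma}\big|\delta_\sigma P^{(n)}(f)-\mu(f)\big|\le 2\,e^{-\lambda n}\sum_{k\in\mathbb Z^d}\operatorname{Var}_k(f),$$ where $\operatorname{Var}_k(f)=\sup\{|f(\sigma)-f(\eta)|:\sigma_j=\eta_j\text{ for all }j\ne k\}$. -/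

import Mathlib

open MeasureTheory ProbabilityTheory Filter Topology

namespace PCA

noncomputable section

/-! ## Sites, spins, configurations -/

/-- Sites: points of `ℤ^d`. -/
abbrev Site (d : ℕ) : Type := Fin d → ℤ

/-- The spin space `{-1, +1}`, as the two units of `ℤ`. -/
abbrev Spin : Type := ℤˣ

/-- Spin configurations on `ℤ^d`, with the product topology and the product `σ`-algebra. -/
abbrev Config (d : ℕ) : Type := Site d → Spin

/-- The spin `s ∈ {-1, +1}` as a real number. -/
def spinVal (s : Spin) : ℝ := ((s : ℤ) : ℝ)

/-- The `σ`-algebra on `{-1, +1}` contains all subsets. -/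
instance instDiscreteSpin : DiscreteMeasurableSpace Spin where
  forall_measurableSet s := by
    refine ⟨Units.val '' s, MeasurableSet.of_discrete, ?_⟩
    exact Set.preimage_image_eq s Units.val_injective

/-- The norm `|k_1| + ... + |k_d|` on `ℤ^d`. -/
def siteNorm {d : ℕ} (k : Site d) : ℕ := ∑ i, (k i).natAbs

/-- There are finitely many sites of norm at most `L`. -/
theorem finite_siteNorm_le {d : ℕ} (L : ℕ) : {k : Site d | siteNorm k ≤ L}.Finite := by
  refine (Set.finite_Icc (fun _ => -(L : ℤ) : Site d) (fun _ => (L : ℤ))).subset ?_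
  intro k hk
  have h : ∀ i, (k i).natAbs ≤ L := fun i =>
    (Finset.single_le_sum (f := fun i => (k i).natAbs) (fun _ _ => Nat.zero_le _)
      (Finset.mem_univ i)).trans hk
  refine ⟨fun i => ?_, fun i => ?_⟩
  · have := h i
    simp only
    omega
  · have := h i
    simp only
    omega

/-- The ball `B_L = {k : |k_1| + ... + |k_d| ≤ L}`. -/
def ball (d L : ℕ) : Finset (Site d) := (finite_siteNorm_le (d := d) L).toFinset

/-! ## The class of dynamics -/

/-- An interaction function `K : ℤ^d → ℝ`, symmetric and of finite range. -/
structure Interaction (d : ℕ) where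
  /-- the interaction function -/
  K : Site d → ℝ
  symm : ∀ k, K (-k) = K k
  finite_range : ∃ R : ℕ, 0 < R ∧ ∀ k, R < siteNorm k → K k = 0

/-- The interaction function vanishes off a finite set. -/
theorem Interaction.finite_support {d : ℕ} (J : Interaction d) : {k | J.K k ≠ 0}.Finite := by
  obtain ⟨R, -, hR⟩ := J.finite_range
  refine (finite_siteNorm_le (d := d) R).subset fun k hk => ?_
  by_contra h
  exact hk (hR k (not_le.mp h))

/-- `p_k(s | η) = (1/2) (1 + s tanh (β ∑_{k'} K(k' - k) η_{k'}))`. -/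
def updateProb {d : ℕ} (β : ℝ) (J : Interaction d) (k : Site d) (η : Config d) (s : Spin) : ℝ :=
  (1 / 2) * (1 + spinVal s * Real.tanh (β * ∑' k', J.K (k' - k) * spinVal (η k')))

/-- The updating rule `p_k(· | η)` as a measure on the spin space. -/
def updateRule {d : ℕ} (β : ℝ) (J : Interaction d) (k : Site d) (η : Config d) : Measure Spin :=
  ∑ s : Spin, ENNReal.ofReal (updateProb β J k η s) • Measure.dirac s

theorem updateProb_nonneg {d : ℕ} (β : ℝ) (J : Interaction d) (k : Site d) (η : Config d)
    (s : Spin) : 0 ≤ updateProb β J k η s := by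
  unfold updateProb
  generalize β * ∑' k', J.K (k' - k) * spinVal (η k') = x
  have h1 := Real.tanh_lt_one x
  have h2 := Real.neg_one_lt_tanh x
  rcases Int.units_eq_one_or s with rfl | rfl <;> simp [spinVal] <;> linarith

instance instProbUpdateRule {d : ℕ} (β : ℝ) (J : Interaction d) (k : Site d) (η : Config d) :
    IsProbabilityMeasure (updateRule β J k η) := by
  constructor
  have h : ∑ s : Spin, updateProb β J k η s = 1 := by
    rw [show (Finset.univ : Finset Spin) = {1, -1} from rfl, Finset.sum_pair (by decide)]
    simp [updateProb, spinVal]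
    ring
  simp only [updateRule, Measure.coe_finsetSum, Finset.sum_apply, Measure.smul_apply,
    measure_univ, smul_eq_mul, mul_one]
  rw [← ENNReal.ofReal_sum_of_nonneg fun s _ => updateProb_nonneg β J k η s, h,
    ENNReal.ofReal_one]

theorem measurable_updateProb {d : ℕ} (β : ℝ) (J : Interaction d) (k : Site d) (s : Spin) :
    Measurable fun η : Config d => updateProb β J k η s := by
  have hfin : {k' | J.K (k' - k) ≠ 0}.Finite :=
    J.finite_support.preimage (sub_left_injective.injOn)
  have hsum : ∀ η : Config d, ∑' k', J.K (k' - k) * spinVal (η k') =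
      ∑ k' ∈ hfin.toFinset, J.K (k' - k) * spinVal (η k') := fun η =>
    tsum_eq_sum fun k' hk' => by
      have : J.K (k' - k) = 0 := by simpa using hk'
      simp [this]
  have hs : Measurable spinVal := Measurable.of_discrete
  have ht : Measurable Real.tanh := by
    have : Real.tanh = fun x => Real.sinh x / Real.cosh x := funext Real.tanh_eq_sinh_div_cosh
    rw [this]
    exact Real.measurable_sinh.div Real.measurable_cosh
  simp only [updateProb, hsum]
  refine ((ht.comp ?_).const_mul _).const_add _ |>.const_mul _
  refine (Finset.measurable_sum _ fun k' _ => ?_).const_mul _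
  exact (hs.comp (measurable_pi_apply k')).const_mul _

/-- The transition kernel `P(dσ | η) = ⊗_k p_k(dσ_k | η)`. -/
def kernel {d : ℕ} (β : ℝ) (J : Interaction d) : Kernel (Config d) (Config d) where
  toFun η := Measure.infinitePi fun k => updateRule β J k η
  measurable' := by
    refine Measurable.measure_of_isPiSystem_of_isProbabilityMeasure
      (generateFrom_squareCylinders (α := fun _ : Site d => Spin)).symm
      (isPiSystem_squareCylinders (fun _ => MeasurableSpace.isPiSystem_measurableSet)
        (fun _ => by simp)) ?_
    rintro A ⟨I, t, ht, rfl⟩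
    have ht' : ∀ k ∈ I, MeasurableSet (t k) := fun k _ => MeasurableSet.of_discrete
    simp only [Measure.infinitePi_pi _ ht']
    refine Finset.measurable_prod _ fun k _ => ?_
    simp only [updateRule, Measure.coe_finsetSum, Finset.sum_apply, Measure.smul_apply,
      smul_eq_mul]
    refine Finset.measurable_sum _ fun s _ => ?_
    exact (measurable_updateProb β J k s).ennreal_ofReal.mul_const _

/-! ## Long-time behaviour of a Markov kernel on configurations -/

/-- `ν P^(n)`, the law at time `n` of the chain with kernel `P` started from `ν`. -/
def lawAt {d : ℕ} (P : Kernel (Config d) (Config d)) (ν : Measure (Config d)) :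
    ℕ → Measure (Config d)
  | 0 => ν
  | n + 1 => (lawAt P ν n).bind P

/-- `P` is ergodic towards the probability measure `μ`: `μ` is the unique stationary probability
measure, and `ν P^(n)` converges weakly to `μ` for every initial probability measure `ν`. -/
structure IsErgodicTowards {d : ℕ} (P : Kernel (Config d) (Config d))
    (μ : Measure (Config d)) : Prop where
  prob : IsProbabilityMeasure μ
  stationary : P.Invariant μ
  unique : ∀ ν : Measure (Config d), IsProbabilityMeasure ν → P.Invariant ν → ν = μ
  tendsto : ∀ ν : Measure (Config d), IsProbabilityMeasure ν →
    ∀ f : BoundedContinuousFunction (Config d) ℝ,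
      Tendsto (fun n => ∫ σ, f σ ∂(lawAt P ν n)) atTop (𝓝 (∫ σ, f σ ∂μ))

/-- `P` is ergodic. -/
def IsErgodic {d : ℕ} (P : Kernel (Config d) (Config d)) : Prop :=
  ∃ μ : Measure (Config d), IsErgodicTowards P μ

/-- A real function on configurations is local if it depends on finitely many spins. -/
def IsLocal {d : ℕ} (f : Config d → ℝ) : Prop :=
  ∃ Λ : Finset (Site d), DependsOn f (Λ : Set (Site d))

/-- The oscillation of `f` at the site `k`: the supremum of `|f σ - f η|` over all `σ`, `η` that
agree off `k`. -/
def oscAt {d : ℕ} (f : Config d → ℝ) (k : Site d) : ℝ :=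
  sSup {x : ℝ | ∃ σ η : Config d, (∀ j, j ≠ k → σ j = η j) ∧ x = |f σ - f η|}

/-- The semi-norm `∑_k Var_k(f)`. -/
def tripleNorm {d : ℕ} (f : Config d → ℝ) : ℝ := ∑' k, oscAt f k

/-- Convergence of `P` towards `μ` with exponential rate, in the uniform norm:
`sup_σ |δ_σ P^(n)(f) - μ(f)| ≤ 2 (∑_k Var_k(f)) e^{-λ n}` for all local `f` and all `n ≥ n₁`, with
`λ` and `n₁` that do not depend on `f`. -/
def ConvergesExponentially {d : ℕ} (P : Kernel (Config d) (Config d))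
    (μ : Measure (Config d)) : Prop :=
  ∃ lam : ℝ, 0 < lam ∧ ∃ n₁ : ℕ, ∀ n : ℕ, n₁ ≤ n → ∀ f : Config d → ℝ, IsLocal f →
    ∀ σ : Config d,
      |∫ ω, f ω ∂(lawAt P (Measure.dirac σ) n) - ∫ ω, f ω ∂μ| ≤
        2 * tripleNorm f * Real.exp (-lam * n)

/-! ## Gibbs measures -/

/-- A potential: a family `φ_A` of real functions on configurations, indexed by the finite sets `A`
of sites. -/
abbrev Potential (d : ℕ) : Type := Finset (Site d) → Config d → ℝ

open Classical in
/-- The potential of the dynamics: `φ_A(σ) = - log cosh (β ∑_j K(k - j) σ_j)` if `A` is the set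
`U_k = {j : K(k - j) ≠ 0}` for some site `k`, and `φ_A = 0` if there is no such `k`.
(If `K ≠ 0` then `k` is determined by `A`, and if `K = 0` then `φ = 0` whatever `k`.) -/
def potential {d : ℕ} (β : ℝ) (J : Interaction d) : Potential d := fun A σ =>
  if h : ∃ k : Site d, (A : Set (Site d)) = {j | J.K (k - j) ≠ 0} then
    -Real.log (Real.cosh (β * ∑' j, J.K (h.choose - j) * spinVal (σ j)))
  else 0

open Classical in
/-- `H_Λ(σ) = ∑_{A : A ∩ Λ ≠ ∅} φ_A(σ)`. -/
def hamiltonian {d : ℕ} (φ : Potential d) (Λ : Finset (Site d)) (σ : Config d) : ℝ :=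
  ∑' A : Finset (Site d), if (A ∩ Λ).Nonempty then φ A σ else 0

open Classical in
/-- The configuration equal to `ξ` on `Λ` and to `τ` off `Λ`. -/
def glue {d : ℕ} (Λ : Finset (Site d)) (ξ : Λ → Spin) (τ : Config d) : Config d :=
  fun k => if h : k ∈ Λ then ξ ⟨k, h⟩ else τ k

/-- The normalisation factor of the finite volume Gibbs measure. -/
def partitionFn {d : ℕ} (φ : Potential d) (Λ : Finset (Site d)) (τ : Config d) : ℝ :=
  ∑ ξ : Λ → Spin, Real.exp (-hamiltonian φ Λ (glue Λ ξ τ))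

/-- The finite volume Gibbs measure `μ_Λ^τ` with boundary condition `τ`, as a measure on
configurations on `ℤ^d` that are equal to `τ` off `Λ`. -/
def finiteGibbs {d : ℕ} (φ : Potential d) (Λ : Finset (Site d)) (τ : Config d) :
    Measure (Config d) :=
  ∑ ξ : Λ → Spin, ENNReal.ofReal
    (Real.exp (-hamiltonian φ Λ (glue Λ ξ τ)) / partitionFn φ Λ τ) • Measure.dirac (glue Λ ξ τ)

/-- The set `G(φ)` of Gibbs measures: the probability measures `μ` such that for every finite `Λ`
the map `σ ↦ μ_Λ^σ` is a version of the conditional law given the spins off `Λ`. -/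
def gibbsMeasures {d : ℕ} (φ : Potential d) : Set (Measure (Config d)) :=
  {μ | IsProbabilityMeasure μ ∧ ∀ (Λ : Finset (Site d)) (A : Set (Config d)), MeasurableSet A →
    μ⟦A | cylinderEvents ((Λ : Set (Site d))ᶜ)⟧ =ᵐ[μ] fun σ => (finiteGibbs φ Λ σ).real A}

/-- Phase transition: there is more than one Gibbs measure. -/
def PhaseTransition {d : ℕ} (φ : Potential d) : Prop := 1 < (gibbsMeasures φ).encard

/-- The weak mixing condition: exponential decay in `L` of the influence on the spin at the origin
of the `+` and `-` boundary conditions off the ball `B_L`. -/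
def WeakMixing {d : ℕ} (φ : Potential d) : Prop :=
  ∃ C : ℝ, 0 < C ∧ ∃ M : ℝ, 0 < M ∧ ∀ L : ℕ, 2 ≤ L →
    ∫ σ, spinVal (σ 0) ∂(finiteGibbs φ (ball d L) fun _ => 1) -
      ∫ σ, spinVal (σ 0) ∂(finiteGibbs φ (ball d L) fun _ => -1) ≤ C * Real.exp (-M * L)

end

end PCA

namespace PCA

noncomputable section

/-! ## Block sums and block averages -/

/-! The proof rests on reversibility, attractivity, and a comparison of the dynamics in finite boxes
with the Gibbs specification.

Freeze the spins off a finite set Λ at s = ±1 and let only those in Λ move. Since K is symmetric,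
detailed balance holds for the product of cosh h_k over k in Λ and of exp(s h_k) over the k off Λ
whose local field h_k involves Λ (`boxWeight_mul_jumpProb_comm`). Well inside Λ this weight is the
Gibbs weight of φ. Limits of these box measures, here `extremal`, are therefore both stationary for
P and Gibbs.

Since K ≥ 0, Holley's inequality applies twice. On weights: log cosh is convex with slope tanh in
(-1, 1), so every Gibbs measure lies between the minus and plus box measures, hence between the two
extremal measures (`gibbs_le_extremal`). On jump probabilities: P preserves monotone functions, and
its iterates lie between those of the minus and plus box dynamics
(`transfer_iterate_le_boxTransfer`). In a box every jump has positive probability, so the box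
dynamics converges to its reversible measure. Letting time and then the box grow, with stationarity
for the opposite bound, P^n f from the all-plus (all-minus) start converges to the integral of f
under the plus (minus) extremal measure.

If P is ergodic, the two extremal measures, both stationary, coincide and squeeze all Gibbs measures
together. If the Gibbs measure is unique, they coincide too, and the law from any start is squeezed
between the laws from the two constant starts.

For the rate, let r(n) be the difference of the mean spin at 0 for the two constant starts.
Conditioning at time n, and bounding P^m σ_0 by functions of the spins in Λ with values in an
interval of length r(m), gives r(n+m) ≤ |Λ| r(m) r(n) / 2 + (gap of the two box measures)
(`discrepancy_add_le`). Consistency and weak mixing turn this into r(2n) ≤ D L^d r(n)^2 + C exp(-ML)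
for all L ≥ 2. As r → 0, taking L of order j at n = 2^j n₀ makes n^d r(n) vanish along that
sequence; taking L = n then produces a sequence with u(2n) ≤ u(n)^2, hence exponential decay
(`exists_exp_decay`). For ordered measures, oscillations bound differences of expectations of local
functions by differences of mean spins (`StochLE.abs_integral_sub_le`), and translation invariance
reduces these to r(n). -/

theorem glue_of_mem {d : ℕ} {Λ : Finset (Site d)} (ξ : Λ → Spin) (τ : Config d) {k : Site d}
    (h : k ∈ Λ) : glue Λ ξ τ k = ξ ⟨k, h⟩ := by
  simp [glue, h]

theorem glue_of_notMem {d : ℕ} {Λ : Finset (Site d)} (ξ : Λ → Spin) (τ : Config d) {k : Site d}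
    (h : k ∉ Λ) : glue Λ ξ τ k = τ k := by
  simp [glue, h]

theorem glue_congr {d : ℕ} {Λ : Finset (Site d)} (ξ : Λ → Spin) {σ τ : Config d}
    (h : ∀ k ∉ Λ, σ k = τ k) : glue Λ ξ σ = glue Λ ξ τ := by
  funext k
  by_cases hk : k ∈ Λ
  · rw [glue_of_mem _ _ hk, glue_of_mem _ _ hk]
  · rw [glue_of_notMem _ _ hk, glue_of_notMem _ _ hk, h k hk]

/-- The configuration equal to `σ` on `Λ` and to `τ` off `Λ`. -/
def pin {d : ℕ} (Λ : Finset (Site d)) (τ σ : Config d) : Config d :=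
  glue Λ (fun i => σ i) τ

theorem pin_of_mem {d : ℕ} {Λ : Finset (Site d)} (τ σ : Config d) {k : Site d}
    (h : k ∈ Λ) : pin Λ τ σ k = σ k := by
  simp [pin, glue_of_mem _ _ h]

theorem pin_of_notMem {d : ℕ} {Λ : Finset (Site d)} (τ σ : Config d) {k : Site d}
    (h : k ∉ Λ) : pin Λ τ σ k = τ k := by
  simp [pin, glue_of_notMem _ _ h]

theorem pin_eq_self {d : ℕ} {Λ : Finset (Site d)} {τ σ : Config d}
    (h : ∀ k ∉ Λ, σ k = τ k) : pin Λ τ σ = σ := by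
  funext k
  by_cases hk : k ∈ Λ
  · rw [pin_of_mem _ _ hk]
  · rw [pin_of_notMem _ _ hk, h k hk]

theorem pin_glue {d : ℕ} {Λ : Finset (Site d)} (ξ : Λ → Spin) (τ : Config d) :
    pin Λ τ (glue Λ ξ τ) = glue Λ ξ τ :=
  pin_eq_self fun _ hk => glue_of_notMem _ _ hk

theorem dependsOn_comp_pin {d : ℕ} (Λ : Finset (Site d)) (τ : Config d) (f : Config d → ℝ) :
    DependsOn (fun σ => f (pin Λ τ σ)) (Λ : Set (Site d)) := by
  intro σ η h
  refine congrArg f (funext fun k => ?_)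
  by_cases hk : k ∈ Λ
  · rw [pin_of_mem _ _ hk, pin_of_mem _ _ hk, h k hk]
  · rw [pin_of_notMem _ _ hk, pin_of_notMem _ _ hk]

theorem apply_pin {d : ℕ} {Λ : Finset (Site d)} {f : Config d → ℝ}
    (hf : DependsOn f (Λ : Set (Site d))) (τ σ : Config d) : f (pin Λ τ σ) = f σ :=
  hf fun _ hk => pin_of_mem _ _ hk

theorem glue_eq_of_dependsOn_compl {d : ℕ} {Λ : Finset (Site d)} {q : Config d → ℝ}
    (hq : DependsOn q ((Λ : Set (Site d))ᶜ)) (ξ : Λ → Spin) (τ : Config d) :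
    q (glue Λ ξ τ) = q τ :=
  hq fun _ hk => glue_of_notMem _ _ (by simpa using hk)

/-- The sum of `g` over all configurations that agree with `τ` off `Λ`. -/
def blockSum {d : ℕ} (Λ : Finset (Site d)) (g : Config d → ℝ) (τ : Config d) : ℝ :=
  ∑ ξ : Λ → Spin, g (glue Λ ξ τ)

theorem dependsOn_blockSum {d : ℕ} (Λ : Finset (Site d)) (g : Config d → ℝ) :
    DependsOn (blockSum Λ g) ((Λ : Set (Site d))ᶜ) := by
  intro σ η h
  unfold blockSum
  refine Finset.sum_congr rfl fun ξ _ => ?_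
  rw [glue_congr ξ fun k hk => h k (by simpa using hk)]

theorem blockSum_mul_left {d : ℕ} {Λ : Finset (Site d)} {q : Config d → ℝ}
    (hq : DependsOn q ((Λ : Set (Site d))ᶜ)) (g : Config d → ℝ) (τ : Config d) :
    blockSum Λ (fun σ => q σ * g σ) τ = q τ * blockSum Λ g τ := by
  simp only [blockSum, glue_eq_of_dependsOn_compl hq, Finset.mul_sum]

theorem blockSum_pos {d : ℕ} {Λ : Finset (Site d)} {w : Config d → ℝ} (hw : ∀ σ, 0 < w σ)
    (τ : Config d) : 0 < blockSum Λ w τ :=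
  Finset.sum_pos (fun _ _ => hw _) Finset.univ_nonempty

/-- Exchange of the spins of two configurations in the smaller of two nested blocks. -/
def exchange {d : ℕ} {Λ Δ : Finset (Site d)} (h : Λ ⊆ Δ) :
    ((Δ → Spin) × (Λ → Spin)) → ((Δ → Spin) × (Λ → Spin)) := fun p =>
  (fun i => if hi : (i : Site d) ∈ Λ then p.2 ⟨i, hi⟩ else p.1 i, fun i => p.1 ⟨i, h i.2⟩)

theorem exchange_involutive {d : ℕ} {Λ Δ : Finset (Site d)} (h : Λ ⊆ Δ) :
    Function.Involutive (exchange h) := by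
  rintro ⟨a, b⟩
  simp only [exchange, Prod.mk.injEq]
  constructor
  · funext i
    by_cases hi : (i : Site d) ∈ Λ <;> simp [hi]
  · funext i
    simp

/-- Exchanging the inner and outer spins on Λ is a bijection of the pairs of patterns, after which
the resulting configuration depends on the first pattern alone; the second only contributes a count.
-/
theorem blockSum_blockSum {d : ℕ} {Λ Δ : Finset (Site d)} (h : Λ ⊆ Δ) (g : Config d → ℝ)
    (τ : Config d) :
    blockSum Δ (blockSum Λ g) τ = Fintype.card (Λ → Spin) * blockSum Δ g τ := by
  have key : ∀ p : (Δ → Spin) × (Λ → Spin),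
      glue Λ p.2 (glue Δ p.1 τ) = glue Δ (exchange h p).1 τ := by
    rintro ⟨a, b⟩
    funext k
    by_cases hk : k ∈ Λ
    · rw [glue_of_mem _ _ hk, glue_of_mem _ _ (h hk)]
      simp [exchange, hk]
    · rw [glue_of_notMem _ _ hk]
      by_cases hk' : k ∈ Δ
      · rw [glue_of_mem _ _ hk', glue_of_mem _ _ hk']
        simp [exchange, hk]
      · rw [glue_of_notMem _ _ hk', glue_of_notMem _ _ hk']
  calc blockSum Δ (blockSum Λ g) τ
      = ∑ p : (Δ → Spin) × (Λ → Spin), g (glue Λ p.2 (glue Δ p.1 τ)) := by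
        rw [Fintype.sum_prod_type]; rfl
    _ = ∑ p : (Δ → Spin) × (Λ → Spin), g (glue Δ (exchange h p).1 τ) := by simp only [key]
    _ = ∑ p : (Δ → Spin) × (Λ → Spin), g (glue Δ p.1 τ) :=
        Equiv.sum_comp (exchange_involutive h).toPerm fun p => g (glue Δ p.1 τ)
    _ = _ := by
        rw [Fintype.sum_prod_type]
        simp [blockSum, Finset.mul_sum]

/-- The average of `f` over all configurations that agree with `τ` off `Λ`, with weight `w`. -/
def blockAvg {d : ℕ} (Λ : Finset (Site d)) (w f : Config d → ℝ) (τ : Config d) : ℝ :=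
  blockSum Λ (fun σ => w σ * f σ) τ / blockSum Λ w τ

theorem blockAvg_eq_sum {d : ℕ} (Λ : Finset (Site d)) (w f : Config d → ℝ) (τ : Config d) :
    blockAvg Λ w f τ =
      ∑ ξ : Λ → Spin, w (glue Λ ξ τ) / blockSum Λ w τ * f (glue Λ ξ τ) := by
  rw [blockAvg, blockSum, Finset.sum_div]
  exact Finset.sum_congr rfl fun ξ _ => by ring

theorem sum_blockAvg_weight {d : ℕ} {Λ : Finset (Site d)} {w : Config d → ℝ}
    (hw : ∀ σ, 0 < w σ) (τ : Config d) :
    ∑ ξ : Λ → Spin, w (glue Λ ξ τ) / blockSum Λ w τ = 1 := by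
  rw [← Finset.sum_div]
  exact div_self (blockSum_pos hw τ).ne'

theorem blockAvg_mono {d : ℕ} {Λ : Finset (Site d)} {w f g : Config d → ℝ}
    (hw : ∀ σ, 0 < w σ) {τ : Config d} (h : ∀ ξ : Λ → Spin, f (glue Λ ξ τ) ≤ g (glue Λ ξ τ)) :
    blockAvg Λ w f τ ≤ blockAvg Λ w g τ := by
  rw [blockAvg_eq_sum, blockAvg_eq_sum]
  exact Finset.sum_le_sum fun ξ _ =>
    mul_le_mul_of_nonneg_left (h ξ) (div_pos (hw _) (blockSum_pos hw τ)).le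

theorem blockAvg_congr {d : ℕ} {Λ : Finset (Site d)} {w f g : Config d → ℝ}
    {τ : Config d} (h : ∀ ξ : Λ → Spin, f (glue Λ ξ τ) = g (glue Λ ξ τ)) :
    blockAvg Λ w f τ = blockAvg Λ w g τ := by
  rw [blockAvg_eq_sum, blockAvg_eq_sum]
  exact Finset.sum_congr rfl fun ξ _ => by rw [h ξ]

theorem blockAvg_const {d : ℕ} {Λ : Finset (Site d)} {w : Config d → ℝ}
    (hw : ∀ σ, 0 < w σ) (c : ℝ) (τ : Config d) : blockAvg Λ w (fun _ => c) τ = c := by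
  rw [blockAvg_eq_sum, ← Finset.sum_mul, sum_blockAvg_weight hw, one_mul]

/-- A factor that does not see the block is constant in numerator and denominator, and cancels. -/
theorem blockAvg_mul_weight {d : ℕ} {Λ : Finset (Site d)} {q : Config d → ℝ}
    (hq : DependsOn q ((Λ : Set (Site d))ᶜ)) (w f : Config d → ℝ) {τ : Config d} (h : q τ ≠ 0) :
    blockAvg Λ (fun σ => q σ * w σ) f τ = blockAvg Λ w f τ := by
  simp only [blockAvg, mul_assoc]
  rw [blockSum_mul_left hq, blockSum_mul_left hq, mul_div_mul_left _ _ h]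

theorem dependsOn_blockAvg_compl {d : ℕ} (Λ : Finset (Site d)) (w f : Config d → ℝ) :
    DependsOn (blockAvg Λ w f) ((Λ : Set (Site d))ᶜ) := by
  intro σ η h
  rw [blockAvg, blockAvg, dependsOn_blockSum Λ _ h, dependsOn_blockSum Λ w h]

theorem dependsOn_blockAvg {d : ℕ} {Λ Δ : Finset (Site d)} {w f : Config d → ℝ}
    (hw : DependsOn w (Δ : Set (Site d))) (hf : DependsOn f (Δ : Set (Site d))) :
    DependsOn (blockAvg Λ w f) (Δ : Set (Site d)) := by
  intro σ η h
  have hg : ∀ ξ : Λ → Spin, ∀ i ∈ (Δ : Set (Site d)), glue Λ ξ σ i = glue Λ ξ η i := by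
    intro ξ i hi
    by_cases hk : i ∈ Λ
    · rw [glue_of_mem _ _ hk, glue_of_mem _ _ hk]
    · rw [glue_of_notMem _ _ hk, glue_of_notMem _ _ hk, h i hi]
  have e1 : ∀ ξ : Λ → Spin, w (glue Λ ξ σ) = w (glue Λ ξ η) := fun ξ => hw (hg ξ)
  have e2 : ∀ ξ : Λ → Spin, f (glue Λ ξ σ) = f (glue Λ ξ η) := fun ξ => hf (hg ξ)
  simp only [blockAvg, blockSum, e1, e2]

/-- Consistency of block averages for nested blocks. -/
theorem blockAvg_blockAvg {d : ℕ} {Λ Δ : Finset (Site d)} (h : Λ ⊆ Δ) {w : Config d → ℝ}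
    (hw : ∀ σ, 0 < w σ) (f : Config d → ℝ) (τ : Config d) :
    blockAvg Δ w (blockAvg Λ w f) τ = blockAvg Δ w f τ := by
  have hc : (Fintype.card (Λ → Spin) : ℝ) ≠ 0 := by positivity
  -- The inner average does not see Λ, so it comes out of the sum over Λ and cancels against the
  -- normalisation.
  have e : blockSum Λ (fun σ => w σ * blockAvg Λ w f σ) = blockSum Λ fun σ => w σ * f σ := by
    funext σ
    simp only [mul_comm (w _) (blockAvg Λ w f _)]
    rw [blockSum_mul_left (dependsOn_blockAvg_compl Λ w f), blockAvg,
      div_mul_cancel₀ _ (blockSum_pos hw σ).ne']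
  rw [blockAvg, blockAvg]
  congr 1
  rw [← mul_right_inj' hc, ← blockSum_blockSum h, ← blockSum_blockSum h, e]

/-! ## Order on configurations -/

theorem spinVal_one : spinVal 1 = 1 := by simp [spinVal]

theorem spinVal_neg_one : spinVal (-1) = -1 := by simp [spinVal]

theorem spin_le_one (s : Spin) : s ≤ 1 := by
  revert s; decide

theorem neg_one_le_spin (s : Spin) : -1 ≤ s := by
  revert s; decide

theorem spinVal_mono : Monotone spinVal := by
  intro a b h
  exact Int.cast_le.2 (show (a : ℤ) ≤ b from h)

theorem spinVal_inf_add_sup (a b : Spin) :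
    spinVal (a ⊓ b) + spinVal (a ⊔ b) = spinVal a + spinVal b := by
  have h : ∀ a b : Spin, ((a ⊓ b : Spin) : ℤ) + ((a ⊔ b : Spin) : ℤ) = a + b := by decide
  unfold spinVal
  exact_mod_cast h a b

theorem le_plus {d : ℕ} (σ : Config d) : σ ≤ fun _ => 1 := fun _ => spin_le_one _

theorem minus_le {d : ℕ} (σ : Config d) : (fun _ => -1) ≤ σ := fun _ => neg_one_le_spin _

theorem glue_mono {d : ℕ} {Λ : Finset (Site d)} {ξ ζ : Λ → Spin} {σ τ : Config d}
    (h : ξ ≤ ζ) (h' : σ ≤ τ) : glue Λ ξ σ ≤ glue Λ ζ τ := by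
  intro k
  by_cases hk : k ∈ Λ
  · rw [glue_of_mem _ _ hk, glue_of_mem _ _ hk]; exact h _
  · rw [glue_of_notMem _ _ hk, glue_of_notMem _ _ hk]; exact h' _

theorem pin_mono {d : ℕ} (Λ : Finset (Site d)) (τ : Config d) : Monotone (pin Λ τ) :=
  fun _ _ h => glue_mono (fun i => h i) le_rfl

theorem le_pin_plus {d : ℕ} (Λ : Finset (Site d)) (σ : Config d) : σ ≤ pin Λ (fun _ => 1) σ := by
  intro k
  by_cases hk : k ∈ Λ
  · rw [pin_of_mem _ _ hk]
  · rw [pin_of_notMem _ _ hk]; exact spin_le_one _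

theorem pin_minus_le {d : ℕ} (Λ : Finset (Site d)) (σ : Config d) :
    pin Λ (fun _ => -1) σ ≤ σ := by
  intro k
  by_cases hk : k ∈ Λ
  · rw [pin_of_mem _ _ hk]
  · rw [pin_of_notMem _ _ hk]; exact neg_one_le_spin _

/-! ## Local fields -/

/-- The sites `j` with `K (k - j) ≠ 0`. -/
def nbhd {d : ℕ} (J : Interaction d) (k : Site d) : Finset (Site d) :=
  (J.finite_support.preimage (sub_right_injective (b := k)).injOn).toFinset

theorem mem_nbhd {d : ℕ} {J : Interaction d} {k j : Site d} : j ∈ nbhd J k ↔ J.K (k - j) ≠ 0 := by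
  simp [nbhd]

theorem Interaction.K_sub_comm {d : ℕ} (J : Interaction d) (k j : Site d) :
    J.K (k - j) = J.K (j - k) := by
  rw [← J.symm, neg_sub]

/-- The sites that interact with some site of `Λ`. -/
def nbhdSet {d : ℕ} (J : Interaction d) (Λ : Finset (Site d)) : Finset (Site d) :=
  Λ.biUnion (nbhd J)

theorem mem_nbhdSet {d : ℕ} {J : Interaction d} {Λ : Finset (Site d)} {k : Site d} :
    k ∈ nbhdSet J Λ ↔ ∃ j ∈ Λ, J.K (k - j) ≠ 0 := by
  simp only [nbhdSet, Finset.mem_biUnion]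
  refine exists_congr fun j => and_congr_right fun _ => ?_
  rw [mem_nbhd, J.K_sub_comm]

theorem nbhd_subset_nbhdSet {d : ℕ} {J : Interaction d} {Λ : Finset (Site d)} {k : Site d}
    (h : k ∈ Λ) : nbhd J k ⊆ nbhdSet J Λ :=
  Finset.subset_biUnion_of_mem (nbhd J) h

/-- The local field `β ∑_j K(k - j) σ_j` at the site `k`. -/
def field {d : ℕ} (β : ℝ) (J : Interaction d) (k : Site d) (σ : Config d) : ℝ :=
  β * ∑' j, J.K (k - j) * spinVal (σ j)

theorem field_eq_sum {d : ℕ} (β : ℝ) (J : Interaction d) {k : Site d} {V : Finset (Site d)}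
    (hV : nbhd J k ⊆ V) (σ : Config d) :
    field β J k σ = β * ∑ j ∈ V, J.K (k - j) * spinVal (σ j) := by
  rw [field, tsum_eq_sum]
  intro j hj
  have : J.K (k - j) = 0 := by
    by_contra h
    exact hj (hV (mem_nbhd.2 h))
  rw [this, zero_mul]

theorem dependsOn_field {d : ℕ} (β : ℝ) (J : Interaction d) (k : Site d) :
    DependsOn (field β J k) (nbhd J k : Set (Site d)) := by
  intro σ η h
  rw [field_eq_sum β J subset_rfl, field_eq_sum β J subset_rfl]
  congr 1
  exact Finset.sum_congr rfl fun j hj => by rw [h j hj]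

theorem dependsOn_field_compl {d : ℕ} (β : ℝ) (J : Interaction d) {Λ : Finset (Site d)}
    {k : Site d} (hk : k ∉ nbhdSet J Λ) :
    DependsOn (field β J k) ((Λ : Set (Site d))ᶜ) := by
  refine (dependsOn_field β J k).mono fun j hj hj' => hk ?_
  exact mem_nbhdSet.2 ⟨j, hj', mem_nbhd.1 hj⟩

theorem field_mono {d : ℕ} {β : ℝ} (hβ : 0 < β) {J : Interaction d} (hJ : ∀ k, 0 ≤ J.K k)
    (k : Site d) : Monotone (field β J k) := by
  intro σ η h
  rw [field_eq_sum β J subset_rfl, field_eq_sum β J subset_rfl]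
  refine mul_le_mul_of_nonneg_left (Finset.sum_le_sum fun j _ => ?_) hβ.le
  exact mul_le_mul_of_nonneg_left (spinVal_mono (h j)) (hJ _)

/-- The field is linear in the spins, and at each site ⊓ and ⊔ merely permute the two spins. This
modularity supplies the relation x + y = u + v in `LogDerivLE`. -/
theorem field_inf_add_sup {d : ℕ} (β : ℝ) (J : Interaction d) (k : Site d) (σ η : Config d) :
    field β J k (σ ⊓ η) + field β J k (σ ⊔ η) = field β J k σ + field β J k η := by
  simp only [field_eq_sum β J subset_rfl, ← mul_add, ← Finset.sum_add_distrib]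
  congr 1
  exact Finset.sum_congr rfl fun j _ => by
    rw [Pi.inf_apply, Pi.sup_apply, spinVal_inf_add_sup]

/-! ## Stochastic comparison of block averages -/

/-- `F` has a smaller logarithmic derivative than `G`, in the form used with Holley's
inequality. -/
def LogDerivLE (F G : ℝ → ℝ) : Prop :=
  ∀ x y u v, x + y = u + v → u ≤ x → u ≤ y → F x * G y ≤ F u * G v

/-- Convexity of log cosh: by the product-to-sum formula, with x + y fixed the product grows with
the distance of the two arguments. -/
theorem logDerivLE_cosh : LogDerivLE Real.cosh Real.cosh := by
  intro x y u v h hx hy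
  have e : ∀ a b, Real.cosh a * Real.cosh b = (Real.cosh (a + b) + Real.cosh (a - b)) / 2 := by
    intro a b
    rw [Real.cosh_add, Real.cosh_sub]; ring
  rw [e, e, h]
  have : Real.cosh (x - y) ≤ Real.cosh (u - v) := by
    rw [Real.cosh_le_cosh, abs_le]
    have := neg_le_abs (u - v)
    constructor <;> linarith
  linarith

/-- The integrated form of tanh ≤ 1; it yields the comparisons of cosh with the two exponentials. -/
theorem cosh_add_le {x δ : ℝ} (hδ : 0 ≤ δ) : Real.cosh (x + δ) ≤ Real.cosh x * Real.exp δ := by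
  have h : Real.exp (-δ) ≤ Real.exp δ := Real.exp_le_exp.2 (by linarith)
  have h2 := mul_le_mul_of_nonneg_left h (Real.exp_pos (-x)).le
  rw [Real.cosh_eq, Real.cosh_eq, neg_add, Real.exp_add, Real.exp_add]
  linarith

theorem logDerivLE_cosh_exp : LogDerivLE Real.cosh Real.exp := by
  intro x y u v h hx _
  have h1 := cosh_add_le (x := u) (sub_nonneg.2 hx)
  have h2 : v = (x - u) + y := by linarith
  rw [h2, Real.exp_add, ← mul_assoc]
  refine mul_le_mul_of_nonneg_right ?_ (Real.exp_pos y).le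
  simpa using h1

theorem logDerivLE_exp_neg_cosh : LogDerivLE (fun x => Real.exp (-x)) Real.cosh := by
  intro x y u v h hx _
  have h1 := cosh_add_le (x := -v) (sub_nonneg.2 hx)
  have h2 : -u = (x - u) + -x := by ring
  have h3 : -v + (x - u) = -y := by linarith
  rw [h3, Real.cosh_neg, Real.cosh_neg] at h1
  simp only
  rw [h2, Real.exp_add, mul_comm (Real.exp (x - u)), mul_assoc]
  refine mul_le_mul_of_nonneg_left ?_ (Real.exp_pos _).le
  linarith

/-- Holley's inequality for the normalised weights, with the test function read at the upper
boundary condition; changing the boundary inside f costs only monotonicity. -/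
theorem blockAvg_le_of_lattice {d : ℕ} {Λ : Finset (Site d)} {w w' : Config d → ℝ}
    (hw : ∀ σ, 0 < w σ) (hw' : ∀ σ, 0 < w' σ) {τ τ' : Config d} (hτ : τ ≤ τ')
    (h : ∀ a b : Λ → Spin, w (glue Λ a τ) * w' (glue Λ b τ') ≤
      w (glue Λ (a ⊓ b) τ) * w' (glue Λ (a ⊔ b) τ'))
    {f : Config d → ℝ} (hf : Monotone f) : blockAvg Λ w f τ ≤ blockAvg Λ w' f τ' := by
  have hZ := blockSum_pos hw (Λ := Λ) τ
  have hZ' := blockSum_pos hw' (Λ := Λ) τ'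
  -- `holley` asks for a nonnegative test function, so the minimum of f is subtracted and restored
  -- afterwards.
  set c := f fun _ => -1 with hc
  have key := holley (μ := fun ξ : Λ → Spin => f (glue Λ ξ τ') - c)
    (f := fun ξ => w (glue Λ ξ τ) / blockSum Λ w τ)
    (g := fun ξ => w' (glue Λ ξ τ') / blockSum Λ w' τ')
    (fun ξ => sub_nonneg.2 (hf (minus_le _))) (fun ξ => (div_pos (hw _) hZ).le)
    (fun ξ => (div_pos (hw' _) hZ').le)
    (fun ξ ζ hξ => sub_le_sub_right (hf (glue_mono hξ le_rfl)) c)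
    (by rw [sum_blockAvg_weight hw, sum_blockAvg_weight hw'])
    (fun a b => by
      rw [div_mul_div_comm, div_mul_div_comm]
      exact div_le_div_of_nonneg_right (h a b) (mul_pos hZ hZ').le)
  simp only [sub_mul, Finset.sum_sub_distrib, ← Finset.mul_sum, sum_blockAvg_weight hw,
    sum_blockAvg_weight hw', sub_le_sub_iff_right] at key
  rw [blockAvg_eq_sum, blockAvg_eq_sum]
  refine le_trans (Finset.sum_le_sum fun ξ _ => ?_) (key.trans (le_of_eq ?_))
  · rw [mul_comm]
    exact mul_le_mul_of_nonneg_right (hf (glue_mono le_rfl hτ)) (div_pos (hw _) hZ).le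
  · exact Finset.sum_congr rfl fun ξ _ => mul_comm _ _

/-- Stochastic comparison of two block averages whose weights are products of functions of the
local fields. -/
theorem blockAvg_le_blockAvg {d : ℕ} {β : ℝ} (hβ : 0 < β) {J : Interaction d}
    (hJ : ∀ k, 0 ≤ J.K k) {Λ V : Finset (Site d)} {F G : Site d → ℝ → ℝ}
    (hF : ∀ k x, 0 < F k x) (hG : ∀ k x, 0 < G k x) (hFG : ∀ k ∈ V, LogDerivLE (F k) (G k))
    {τ τ' : Config d} (hτ : τ ≤ τ') {f : Config d → ℝ} (hf : Monotone f) :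
    blockAvg Λ (fun σ => ∏ k ∈ V, F k (field β J k σ)) f τ ≤
      blockAvg Λ (fun σ => ∏ k ∈ V, G k (field β J k σ)) f τ' := by
  refine blockAvg_le_of_lattice (fun σ => Finset.prod_pos fun k _ => hF _ _)
    (fun σ => Finset.prod_pos fun k _ => hG _ _) hτ (fun a b => ?_) hf
  rw [← Finset.prod_mul_distrib, ← Finset.prod_mul_distrib]
  refine Finset.prod_le_prod (fun k _ => (mul_pos (hF _ _) (hG _ _)).le) fun k hk => ?_
  -- As τ ≤ τ', the boundary conditions are themselves the infimum and supremum, so lattice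
  -- operations in the block are lattice operations on whole configurations.
  have e1 : glue Λ (a ⊓ b) τ = glue Λ a τ ⊓ glue Λ b τ' := by
    funext k
    by_cases hk : k ∈ Λ
    · simp [glue_of_mem _ _ hk]
    · simpa [glue_of_notMem _ _ hk] using hτ k
  have e2 : glue Λ (a ⊔ b) τ' = glue Λ a τ ⊔ glue Λ b τ' := by
    funext k
    by_cases hk : k ∈ Λ
    · simp [glue_of_mem _ _ hk]
    · simpa [glue_of_notMem _ _ hk] using hτ k
  refine hFG k hk _ _ _ _ ?_ ?_ ?_
  · rw [e1, e2, field_inf_add_sup]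
  · exact field_mono hβ hJ k (glue_mono inf_le_left le_rfl)
  · exact field_mono hβ hJ k (glue_mono inf_le_right hτ)

/-- The Gibbs weight of the block `Λ`. -/
def gibbsWeight {d : ℕ} (β : ℝ) (J : Interaction d) (Λ : Finset (Site d)) (σ : Config d) : ℝ :=
  ∏ k ∈ nbhdSet J Λ, Real.cosh (field β J k σ)

/-- The weight of the reversible measure of the dynamics restricted to `Λ`, with boundary
condition `s`. -/
def boxWeight {d : ℕ} (β : ℝ) (J : Interaction d) (s : Spin) (Λ : Finset (Site d))
    (σ : Config d) : ℝ :=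
  ∏ k ∈ Λ ∪ nbhdSet J Λ,
    if k ∈ Λ then Real.cosh (field β J k σ) else Real.exp (spinVal s * field β J k σ)

theorem gibbsWeight_pos {d : ℕ} (β : ℝ) (J : Interaction d) (Λ : Finset (Site d))
    (σ : Config d) : 0 < gibbsWeight β J Λ σ :=
  Finset.prod_pos fun _ _ => Real.cosh_pos _

theorem boxWeight_pos {d : ℕ} (β : ℝ) (J : Interaction d) (s : Spin) (Λ : Finset (Site d))
    (σ : Config d) : 0 < boxWeight β J s Λ σ := by
  refine Finset.prod_pos fun k _ => ?_
  split_ifs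
  exacts [Real.cosh_pos _, Real.exp_pos _]

/-- Averages with respect to the Gibbs specification. -/
def gibbsAvg {d : ℕ} (β : ℝ) (J : Interaction d) (Λ : Finset (Site d)) (f : Config d → ℝ)
    (τ : Config d) : ℝ :=
  blockAvg Λ (gibbsWeight β J Λ) f τ

/-- Averages with respect to the reversible measure of the dynamics restricted to `Λ`, with
boundary condition `s`. -/
def boxAvg {d : ℕ} (β : ℝ) (J : Interaction d) (s : Spin) (Λ : Finset (Site d))
    (f : Config d → ℝ) : ℝ :=
  blockAvg Λ (boxWeight β J s Λ) f fun _ => s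

theorem gibbsAvg_mono_boundary {d : ℕ} {β : ℝ} (hβ : 0 < β) {J : Interaction d}
    (hJ : ∀ k, 0 ≤ J.K k) (Λ : Finset (Site d)) {f : Config d → ℝ} (hf : Monotone f) :
    Monotone (gibbsAvg β J Λ f) := fun _ _ hτ =>
  blockAvg_le_blockAvg hβ hJ (F := fun _ => Real.cosh) (G := fun _ => Real.cosh)
    (fun _ => Real.cosh_pos) (fun _ => Real.cosh_pos) (fun _ _ => logDerivLE_cosh) hτ hf

theorem dependsOn_comp_field_compl {d : ℕ} (β : ℝ) (J : Interaction d) {Λ V : Finset (Site d)}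
    (hV : Disjoint V (nbhdSet J Λ)) (F : Site d → ℝ → ℝ) :
    DependsOn (fun σ => ∏ k ∈ V, F k (field β J k σ)) ((Λ : Set (Site d))ᶜ) := by
  intro σ η h
  refine Finset.prod_congr rfl fun k hk => ?_
  rw [dependsOn_field_compl β J (Finset.disjoint_left.1 hV hk) h]

/-- Only the fields at sites of `nbhdSet J Λ` see Λ, so factors at other sites are arbitrary. This
allows weights on a common index set to be compared, and yields consistency in boxes. -/
theorem gibbsAvg_eq_blockAvg {d : ℕ} (β : ℝ) (J : Interaction d) {Λ V : Finset (Site d)}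
    (hV : nbhdSet J Λ ⊆ V) {F : Site d → ℝ → ℝ} (hF : ∀ k x, 0 < F k x)
    (hF' : ∀ k ∈ nbhdSet J Λ, F k = Real.cosh) (f : Config d → ℝ) (τ : Config d) :
    blockAvg Λ (fun σ => ∏ k ∈ V, F k (field β J k σ)) f τ = gibbsAvg β J Λ f τ := by
  have e : (fun σ => ∏ k ∈ V, F k (field β J k σ)) =
      fun σ => (∏ k ∈ V \ nbhdSet J Λ, F k (field β J k σ)) * gibbsWeight β J Λ σ := by
    funext σ
    rw [← Finset.prod_sdiff hV, gibbsWeight]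
    congr 1
    exact Finset.prod_congr rfl fun k hk => by rw [hF' k hk]
  rw [e, gibbsAvg, blockAvg_mul_weight (dependsOn_comp_field_compl β J Finset.sdiff_disjoint F)]
  exact (Finset.prod_pos fun k _ => hF _ _).ne'

/-- The factors of `boxWeight`. -/
def boxFactor {d : ℕ} (s : Spin) (Λ : Finset (Site d)) (k : Site d) (x : ℝ) : ℝ :=
  if k ∈ Λ then Real.cosh x else Real.exp (spinVal s * x)

theorem boxFactor_pos {d : ℕ} (s : Spin) (Λ : Finset (Site d)) (k : Site d) (x : ℝ) :
    0 < boxFactor s Λ k x := by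
  unfold boxFactor
  split_ifs
  exacts [Real.cosh_pos _, Real.exp_pos _]

/-- Passing from cosh to exp at the sites off Λ raises the logarithmic slope from tanh to 1, and
all-plus is the largest boundary condition. The bound is uniform in τ. -/
theorem gibbsAvg_le_boxAvg {d : ℕ} {β : ℝ} (hβ : 0 < β) {J : Interaction d}
    (hJ : ∀ k, 0 ≤ J.K k) (Λ : Finset (Site d)) {f : Config d → ℝ} (hf : Monotone f)
    (τ : Config d) : gibbsAvg β J Λ f τ ≤ boxAvg β J 1 Λ f := by
  rw [← gibbsAvg_eq_blockAvg β J (Finset.subset_union_right (s₁ := Λ))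
    (F := fun _ => Real.cosh) (fun _ => Real.cosh_pos) (fun _ _ => rfl)]
  refine blockAvg_le_blockAvg hβ hJ (F := fun _ => Real.cosh) (G := boxFactor 1 Λ)
    (fun _ => Real.cosh_pos) (boxFactor_pos 1 Λ) (fun k _ => ?_) (le_plus τ) hf
  unfold boxFactor
  split_ifs
  · exact logDerivLE_cosh
  · simpa [spinVal_one] using logDerivLE_cosh_exp

theorem boxAvg_le_gibbsAvg {d : ℕ} {β : ℝ} (hβ : 0 < β) {J : Interaction d}
    (hJ : ∀ k, 0 ≤ J.K k) (Λ : Finset (Site d)) {f : Config d → ℝ} (hf : Monotone f)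
    (τ : Config d) : boxAvg β J (-1) Λ f ≤ gibbsAvg β J Λ f τ := by
  rw [← gibbsAvg_eq_blockAvg β J (Finset.subset_union_right (s₁ := Λ))
    (F := fun _ => Real.cosh) (fun _ => Real.cosh_pos) (fun _ _ => rfl)]
  refine blockAvg_le_blockAvg hβ hJ (F := boxFactor (-1) Λ) (G := fun _ => Real.cosh)
    (boxFactor_pos (-1) Λ) (fun _ => Real.cosh_pos) (fun k _ => ?_) (minus_le τ) hf
  unfold boxFactor
  split_ifs
  · exact logDerivLE_cosh
  · simpa [spinVal_neg_one] using logDerivLE_exp_neg_cosh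

/-- The box averages satisfy the Gibbs consistency relation well inside the box. -/
theorem boxAvg_gibbsAvg {d : ℕ} (β : ℝ) (J : Interaction d) (s : Spin) {Λ Δ : Finset (Site d)}
    (h : Λ ⊆ Δ) (h' : nbhdSet J Λ ⊆ Δ) (f : Config d → ℝ) :
    boxAvg β J s Δ (gibbsAvg β J Λ f) = boxAvg β J s Δ f := by
  -- Every factor of the box weight of Δ that sees Λ is a cosh, because `nbhdSet J Λ` lies in Δ.
  have e : gibbsAvg β J Λ f = blockAvg Λ (boxWeight β J s Δ) f := by
    funext τ
    exact (gibbsAvg_eq_blockAvg β J (h'.trans Finset.subset_union_left)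
      (F := boxFactor s Δ) (boxFactor_pos s Δ)
      (fun k hk => by funext x; simp [boxFactor, h' hk]) f τ).symm
  rw [e]
  exact blockAvg_blockAvg h (boxWeight_pos β J s Δ) f _

/-! ## The transition operator on local functions -/

/-- In this form the denominator is what the cosh factors of `boxWeight` cancel in detailed balance.
Symmetry of K identifies the argument of tanh with `field`. -/
theorem updateProb_eq {d : ℕ} (β : ℝ) (J : Interaction d) (k : Site d) (η : Config d) (s : Spin) :
    updateProb β J k η s =
      Real.exp (spinVal s * field β J k η) / (2 * Real.cosh (field β J k η)) := by
  have e : β * ∑' k', J.K (k' - k) * spinVal (η k') = field β J k η := by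
    simp only [field, J.K_sub_comm k]
  rw [updateProb, e, Real.tanh_eq_sinh_div_cosh]
  have hc := (Real.cosh_pos (field β J k η)).ne'
  have h1 := Real.cosh_add_sinh (field β J k η)
  have h2 := Real.cosh_sub_sinh (field β J k η)
  rcases Int.units_eq_one_or s with rfl | rfl
  · rw [spinVal_one, one_mul, one_mul, ← h1]; field_simp
  · rw [spinVal_neg_one, neg_one_mul, neg_one_mul, ← h2]; field_simp; ring

theorem updateProb_pos {d : ℕ} (β : ℝ) (J : Interaction d) (k : Site d) (η : Config d)
    (s : Spin) : 0 < updateProb β J k η s := by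
  rw [updateProb_eq]
  exact div_pos (Real.exp_pos _) (mul_pos two_pos (Real.cosh_pos _))

theorem updateProb_one_add {d : ℕ} (β : ℝ) (J : Interaction d) (k : Site d) (η : Config d) :
    updateProb β J k η 1 + updateProb β J k η (-1) = 1 := by
  simp only [updateProb, spinVal_one, spinVal_neg_one]
  ring

theorem updateProb_one_mono {d : ℕ} {β : ℝ} (hβ : 0 < β) {J : Interaction d}
    (hJ : ∀ k, 0 ≤ J.K k) (k : Site d) : Monotone fun η => updateProb β J k η 1 := by
  intro σ η h
  have hx := field_mono hβ hJ k h
  -- The logistic form, where monotonicity in x is visible.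
  have e : ∀ x, Real.exp x / (2 * Real.cosh x) = (1 + Real.exp (-(2 * x)))⁻¹ := by
    intro x
    have h1 : Real.exp (-x) = Real.exp x * Real.exp (-(2 * x)) := by
      rw [← Real.exp_add]; ring_nf
    have := Real.exp_pos x
    have := Real.exp_pos (-(2 * x))
    rw [Real.cosh_eq, h1]
    field_simp
  simp only [updateProb_eq, spinVal_one, one_mul, e]
  gcongr

/-- The probability that the dynamics jumps from `η` to a configuration equal to `ξ` on `Λ`. -/
def jumpProb {d : ℕ} (β : ℝ) (J : Interaction d) (Λ : Finset (Site d)) (η : Config d)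
    (ξ : Λ → Spin) : ℝ :=
  ∏ k : Λ, updateProb β J k η (ξ k)

theorem jumpProb_pos {d : ℕ} (β : ℝ) (J : Interaction d) (Λ : Finset (Site d)) (η : Config d)
    (ξ : Λ → Spin) : 0 < jumpProb β J Λ η ξ :=
  Finset.prod_pos fun _ _ => updateProb_pos _ _ _ _ _

/-- The transition operator of the dynamics. -/
def transfer {d : ℕ} (β : ℝ) (J : Interaction d) (f : Config d → ℝ) (η : Config d) : ℝ :=
  ∫ ω, f ω ∂(kernel β J η)

theorem kernel_apply {d : ℕ} (β : ℝ) (J : Interaction d) (η : Config d) :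
    kernel β J η = Measure.infinitePi fun k => updateRule β J k η := rfl

instance instIsMarkovKernelKernel {d : ℕ} (β : ℝ) (J : Interaction d) :
    IsMarkovKernel (kernel β J) :=
  ⟨fun η => by rw [kernel_apply]; infer_instance⟩

theorem updateRule_singleton {d : ℕ} (β : ℝ) (J : Interaction d) (k : Site d) (η : Config d)
    (s : Spin) : updateRule β J k η {s} = ENNReal.ofReal (updateProb β J k η s) := by
  simp only [updateRule, Measure.coe_finsetSum, Finset.sum_apply, Measure.smul_apply,
    smul_eq_mul]
  rw [Finset.sum_eq_single s]
  · simp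
  · intro b _ hb
    simp [hb]
  · exact fun h => absurd (Finset.mem_univ s) h

/-- The configuration τ only fills the sites off Λ, which f ignores; it may be chosen to suit each
use. -/
theorem transfer_eq_sum {d : ℕ} (β : ℝ) (J : Interaction d) {Λ : Finset (Site d)}
    {f : Config d → ℝ} (hf : DependsOn f (Λ : Set (Site d))) (τ η : Config d) :
    transfer β J f η = ∑ ξ : Λ → Spin, jumpProb β J Λ η ξ * f (glue Λ ξ τ) := by
  have e : f = fun σ => (fun ξ : Λ → Spin => f (glue Λ ξ τ)) (Λ.restrict σ) := by
    funext σ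
    exact (apply_pin hf τ σ).symm
  have h := integral_restrict_infinitePi (μ := fun k => updateRule β J k η)
    (Measurable.of_discrete (f := fun ξ : Λ → Spin => f (glue Λ ξ τ))).aestronglyMeasurable
  rw [transfer, kernel_apply, integral_congr_ae (.of_forall fun σ => congrFun e σ), h,
    integral_fintype (.of_finite)]
  refine Finset.sum_congr rfl fun ξ _ => ?_
  rw [smul_eq_mul, Measure.real, ← Set.univ_pi_singleton, Measure.pi_pi]
  simp only [updateRule_singleton]
  rw [ENNReal.toReal_prod, jumpProb]
  congr 1
  exact Finset.prod_congr rfl fun k _ => ENNReal.toReal_ofReal (updateProb_nonneg _ _ _ _ _)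

theorem sum_jumpProb {d : ℕ} (β : ℝ) (J : Interaction d) (Λ : Finset (Site d)) (η : Config d) :
    ∑ ξ : Λ → Spin, jumpProb β J Λ η ξ = 1 := by
  have h := transfer_eq_sum β J (Λ := Λ) (f := fun _ => 1) (fun _ _ _ => rfl) η η
  simp only [mul_one] at h
  rw [← h, transfer]
  simp

theorem updateProb_congr {d : ℕ} (β : ℝ) (J : Interaction d) {k : Site d} {σ η : Config d}
    (h : ∀ j ∈ nbhd J k, σ j = η j) (s : Spin) :
    updateProb β J k σ s = updateProb β J k η s := by
  rw [updateProb_eq, updateProb_eq, dependsOn_field β J k h]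

theorem dependsOn_transfer {d : ℕ} (β : ℝ) (J : Interaction d) {Λ : Finset (Site d)}
    {f : Config d → ℝ} (hf : DependsOn f (Λ : Set (Site d))) :
    DependsOn (transfer β J f) (nbhdSet J Λ : Set (Site d)) := by
  intro σ η h
  rw [transfer_eq_sum β J hf σ, transfer_eq_sum β J hf σ]
  refine Finset.sum_congr rfl fun ξ _ => ?_
  congr 1
  exact Finset.prod_congr rfl fun k _ =>
    updateProb_congr β J (fun j hj => h j (nbhd_subset_nbhdSet k.2 hj)) _

theorem IsLocal.transfer {d : ℕ} (β : ℝ) (J : Interaction d) {f : Config d → ℝ}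
    (hf : IsLocal f) : IsLocal (transfer β J f) :=
  let ⟨Λ, h⟩ := hf
  ⟨nbhdSet J Λ, dependsOn_transfer β J h⟩

/-- The Holley condition at one site. It is an equality except for a = 1, b = -1, where it says that
raising η raises the probability of a plus. -/
theorem updateProb_mul_le {d : ℕ} {β : ℝ} (hβ : 0 < β) {J : Interaction d}
    (hJ : ∀ k, 0 ≤ J.K k) (k : Site d) {σ η : Config d} (h : σ ≤ η) (a b : Spin) :
    updateProb β J k σ a * updateProb β J k η b ≤
      updateProb β J k σ (a ⊓ b) * updateProb β J k η (a ⊔ b) := by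
  rcases le_total a b with hab | hab
  · rw [inf_eq_left.2 hab, sup_eq_right.2 hab]
  · rw [inf_eq_right.2 hab, sup_eq_left.2 hab]
    have h1 : updateProb β J k σ 1 ≤ updateProb β J k η 1 := updateProb_one_mono hβ hJ k h
    have h2 := updateProb_one_add β J k σ
    have h3 := updateProb_one_add β J k η
    rcases Int.units_eq_one_or a with rfl | rfl <;> rcases Int.units_eq_one_or b with rfl | rfl
    · rfl
    · rw [mul_comm]
      exact mul_le_mul (by linarith) h1 (updateProb_nonneg _ _ _ _ _) (updateProb_nonneg _ _ _ _ _)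
    · exact absurd hab (by decide)
    · rfl

/-- Attractivity: the one-site conditions multiply over Λ, and Holley's inequality compares the
jumps from σ and from η. -/
theorem transfer_monotone {d : ℕ} {β : ℝ} (hβ : 0 < β) {J : Interaction d}
    (hJ : ∀ k, 0 ≤ J.K k) {f : Config d → ℝ} (hf : Monotone f) (hl : IsLocal f) :
    Monotone (transfer β J f) := by
  obtain ⟨Λ, hΛ⟩ := hl
  intro σ η h
  rw [transfer_eq_sum β J hΛ (fun _ => -1), transfer_eq_sum β J hΛ (fun _ => -1)]
  set c := f fun _ => -1 with hc
  have key := holley (μ := fun ξ : Λ → Spin => f (glue Λ ξ fun _ => -1) - c)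
    (f := jumpProb β J Λ σ) (g := jumpProb β J Λ η)
    (fun ξ => sub_nonneg.2 (hf (minus_le _))) (fun ξ => (jumpProb_pos _ _ _ _ _).le)
    (fun ξ => (jumpProb_pos _ _ _ _ _).le)
    (fun ξ ζ hξ => sub_le_sub_right (hf (glue_mono hξ le_rfl)) c)
    (by rw [sum_jumpProb, sum_jumpProb])
    (fun a b => by
      simp only [jumpProb, ← Finset.prod_mul_distrib]
      refine Finset.prod_le_prod (fun k _ => ?_) fun k _ => updateProb_mul_le hβ hJ k h _ _
      exact (mul_pos (updateProb_pos _ _ _ _ _) (updateProb_pos _ _ _ _ _)).le)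
  simp only [sub_mul, Finset.sum_sub_distrib, ← Finset.mul_sum, sum_jumpProb,
    sub_le_sub_iff_right] at key
  simpa only [mul_comm] using key

theorem transfer_iterate_monotone_local {d : ℕ} {β : ℝ} (hβ : 0 < β) {J : Interaction d}
    (hJ : ∀ k, 0 ≤ J.K k) {f : Config d → ℝ} (hf : Monotone f) (hl : IsLocal f) (n : ℕ) :
    Monotone ((transfer β J)^[n] f) ∧ IsLocal ((transfer β J)^[n] f) := by
  induction n with
  | zero => exact ⟨hf, hl⟩
  | succ n ih =>
    rw [Function.iterate_succ_apply']
    exact ⟨transfer_monotone hβ hJ ih.1 ih.2, ih.2.transfer β J⟩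

theorem IsLocal.transfer_iterate {d : ℕ} (β : ℝ) (J : Interaction d) {f : Config d → ℝ}
    (hl : IsLocal f) (n : ℕ) : IsLocal ((PCA.transfer β J)^[n] f) := by
  induction n with
  | zero => exact hl
  | succ n ih =>
    rw [Function.iterate_succ_apply']
    exact ih.transfer β J

theorem transfer_le_transfer {d : ℕ} (β : ℝ) (J : Interaction d) {f g : Config d → ℝ}
    (hf : IsLocal f) (hg : IsLocal g) (h : ∀ σ, f σ ≤ g σ) (η : Config d) :
    transfer β J f η ≤ transfer β J g η := by
  obtain ⟨Λ, hΛ⟩ := hf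
  obtain ⟨Δ, hΔ⟩ := hg
  have h1 := hΛ.mono (t := ((Λ ∪ Δ : Finset _) : Set (Site d))) (by simp)
  have h2 := hΔ.mono (t := ((Λ ∪ Δ : Finset _) : Set (Site d))) (by simp)
  rw [transfer_eq_sum β J h1 η, transfer_eq_sum β J h2 η]
  exact Finset.sum_le_sum fun ξ _ =>
    mul_le_mul_of_nonneg_left (h _) (jumpProb_pos _ _ _ _ _).le

/-! ## Reversibility in boxes -/

/-- Both sides are a bilinear form with kernel K(k - j). Over V × V it is symmetric because K is. A
nonzero term with j outside V has both k and j off Λ, where the two configurations agree. -/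
theorem sum_mul_field_comm {d : ℕ} (β : ℝ) (J : Interaction d) {Λ : Finset (Site d)}
    {σ η : Config d} (h : ∀ k ∉ Λ, σ k = η k) :
    ∑ k ∈ Λ ∪ nbhdSet J Λ, spinVal (η k) * field β J k σ =
      ∑ k ∈ Λ ∪ nbhdSet J Λ, spinVal (σ k) * field β J k η := by
  set V := Λ ∪ nbhdSet J Λ with hV
  set W := V ∪ nbhdSet J V with hW
  have hVW : V ⊆ W := Finset.subset_union_left
  have e : ∀ σ η : Config d, ∑ k ∈ V, spinVal (η k) * field β J k σ =
      β * (∑ k ∈ V, ∑ j ∈ W \ V, J.K (k - j) * (spinVal (η k) * spinVal (σ j)) +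
        ∑ k ∈ V, ∑ j ∈ V, J.K (k - j) * (spinVal (η k) * spinVal (σ j))) := by
    intro σ η
    rw [← Finset.sum_add_distrib, Finset.mul_sum]
    refine Finset.sum_congr rfl fun k hk => ?_
    rw [Finset.sum_sdiff hVW,
      field_eq_sum β J ((nbhd_subset_nbhdSet hk).trans Finset.subset_union_right),
      mul_left_comm, Finset.mul_sum]
    congr 1
    exact Finset.sum_congr rfl fun j _ => by ring
  rw [e, e]
  congr 2
  · refine Finset.sum_congr rfl fun k _ => Finset.sum_congr rfl fun j hj => ?_
    have hj' := (Finset.mem_sdiff.1 hj).2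
    by_cases hK : J.K (k - j) = 0
    · rw [hK, zero_mul, zero_mul]
    · have hk : k ∉ Λ := fun hk => hj' (Finset.mem_union_right _
        (nbhd_subset_nbhdSet hk (mem_nbhd.2 hK)))
      have hjΛ : j ∉ Λ := fun hjΛ => hj' (Finset.mem_union_left _ hjΛ)
      rw [h k hk, h j hjΛ]
  · rw [Finset.sum_comm]
    refine Finset.sum_congr rfl fun k _ => Finset.sum_congr rfl fun j _ => ?_
    rw [J.K_sub_comm, mul_comm (spinVal (η j))]

/-- In Λ the cosh cancels against the normalisation of the update, leaving 1/2. Off Λ the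
exponential factor of the weight acts as a jump to the frozen spin s. -/
theorem boxWeight_mul_jumpProb {d : ℕ} (β : ℝ) (J : Interaction d) (s : Spin)
    (Λ : Finset (Site d)) (ξ ζ : Λ → Spin) :
    boxWeight β J s Λ (glue Λ ξ fun _ => s) * jumpProb β J Λ (glue Λ ξ fun _ => s) ζ =
      (∏ k ∈ Λ ∪ nbhdSet J Λ, if k ∈ Λ then (1 / 2 : ℝ) else 1) *
        Real.exp (∑ k ∈ Λ ∪ nbhdSet J Λ,
          spinVal (glue Λ ζ (fun _ => s) k) * field β J k (glue Λ ξ fun _ => s)) := by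
  set σ := glue Λ ξ fun _ => s
  set η := glue Λ ζ fun _ => s with hη
  have e : jumpProb β J Λ σ ζ = ∏ k ∈ Λ ∪ nbhdSet J Λ,
      if k ∈ Λ then updateProb β J k σ (η k) else 1 := by
    rw [Finset.prod_ite_mem, Finset.union_inter_cancel_left, ← Finset.prod_coe_sort, jumpProb]
    exact Finset.prod_congr rfl fun k _ => by rw [hη, glue_of_mem _ _ k.2]
  rw [e, boxWeight, Real.exp_sum, ← Finset.prod_mul_distrib, ← Finset.prod_mul_distrib]
  refine Finset.prod_congr rfl fun k _ => ?_
  by_cases hk : k ∈ Λ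
  · simp only [hk, if_true]
    rw [updateProb_eq]
    have := Real.cosh_pos (field β J k σ)
    field_simp
  · simp only [hk, if_false]
    rw [hη, glue_of_notMem _ _ hk, mul_one, one_mul]

/-- Detailed balance for the dynamics in a box. -/
theorem boxWeight_mul_jumpProb_comm {d : ℕ} (β : ℝ) (J : Interaction d) (s : Spin)
    (Λ : Finset (Site d)) (ξ ζ : Λ → Spin) :
    boxWeight β J s Λ (glue Λ ξ fun _ => s) * jumpProb β J Λ (glue Λ ξ fun _ => s) ζ =
      boxWeight β J s Λ (glue Λ ζ fun _ => s) * jumpProb β J Λ (glue Λ ζ fun _ => s) ξ := by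
  rw [boxWeight_mul_jumpProb, boxWeight_mul_jumpProb, sum_mul_field_comm]
  intro k hk
  rw [glue_of_notMem _ _ hk, glue_of_notMem _ _ hk]

/-- Detailed balance gives invariance. The unrestricted operator may be used: the configurations
averaged over already carry s off Λ, and f sees only the jumps in Λ. -/
theorem boxAvg_transfer {d : ℕ} (β : ℝ) (J : Interaction d) (s : Spin) {Λ : Finset (Site d)}
    {f : Config d → ℝ} (hf : DependsOn f (Λ : Set (Site d))) :
    boxAvg β J s Λ (transfer β J f) = boxAvg β J s Λ f := by
  rw [boxAvg, boxAvg, blockAvg, blockAvg]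
  congr 1
  simp only [blockSum, transfer_eq_sum β J hf (fun _ => s), Finset.mul_sum, ← mul_assoc]
  rw [Finset.sum_comm]
  refine Finset.sum_congr rfl fun ζ _ => ?_
  rw [← Finset.sum_mul]
  congr 1
  simp only [boxWeight_mul_jumpProb_comm β J s Λ _ ζ]
  rw [← Finset.mul_sum, sum_jumpProb, mul_one]

/-! ## The dynamics in a box -/

/-- The transition operator of the dynamics in `Λ` with boundary condition `s`. -/
def boxTransfer {d : ℕ} (β : ℝ) (J : Interaction d) (s : Spin) (Λ : Finset (Site d))
    (f : Config d → ℝ) (η : Config d) : ℝ :=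
  transfer β J f (pin Λ (fun _ => s) η)

theorem dependsOn_boxTransfer {d : ℕ} (β : ℝ) (J : Interaction d) (s : Spin)
    (Λ : Finset (Site d)) (f : Config d → ℝ) :
    DependsOn (boxTransfer β J s Λ f) (Λ : Set (Site d)) :=
  dependsOn_comp_pin Λ _ (transfer β J f)

theorem dependsOn_boxTransfer_iterate {d : ℕ} (β : ℝ) (J : Interaction d) (s : Spin)
    {Λ : Finset (Site d)} {f : Config d → ℝ} (hf : DependsOn f (Λ : Set (Site d))) (n : ℕ) :
    DependsOn ((boxTransfer β J s Λ)^[n] f) (Λ : Set (Site d)) := by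
  cases n with
  | zero => exact hf
  | succ n =>
    rw [Function.iterate_succ_apply']
    exact dependsOn_boxTransfer β J s Λ _

theorem boxTransfer_iterate_monotone {d : ℕ} {β : ℝ} (hβ : 0 < β) {J : Interaction d}
    (hJ : ∀ k, 0 ≤ J.K k) (s : Spin) {Λ : Finset (Site d)} {f : Config d → ℝ}
    (hf : DependsOn f (Λ : Set (Site d))) (hm : Monotone f) (n : ℕ) :
    Monotone ((boxTransfer β J s Λ)^[n] f) := by
  induction n with
  | zero => exact hm
  | succ n ih =>
    rw [Function.iterate_succ_apply']
    exact (transfer_monotone hβ hJ ih ⟨Λ, dependsOn_boxTransfer_iterate β J s hf n⟩).comp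
      (pin_mono Λ _)

theorem boxAvg_boxTransfer_iterate {d : ℕ} (β : ℝ) (J : Interaction d) (s : Spin)
    {Λ : Finset (Site d)} {f : Config d → ℝ} (hf : DependsOn f (Λ : Set (Site d))) (n : ℕ) :
    boxAvg β J s Λ ((boxTransfer β J s Λ)^[n] f) = boxAvg β J s Λ f := by
  induction n with
  | zero => rfl
  | succ n ih =>
    rw [Function.iterate_succ_apply', ← ih,
      ← boxAvg_transfer β J s (dependsOn_boxTransfer_iterate β J s hf n)]
    exact blockAvg_congr fun ξ => by rw [boxTransfer, pin_glue]

/-- At each step, resetting the spins off Λ to plus raises the configuration, and attractivity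
carries the inequality along. -/
theorem transfer_iterate_le_boxTransfer {d : ℕ} {β : ℝ} (hβ : 0 < β) {J : Interaction d}
    (hJ : ∀ k, 0 ≤ J.K k) {Λ : Finset (Site d)} {f : Config d → ℝ}
    (hf : DependsOn f (Λ : Set (Site d))) (hm : Monotone f) (n : ℕ) (σ : Config d) :
    (transfer β J)^[n] f σ ≤ (boxTransfer β J 1 Λ)^[n] f σ := by
  induction n generalizing σ with
  | zero => exact le_refl (f σ)
  | succ n ih =>
    have hl : IsLocal ((boxTransfer β J 1 Λ)^[n] f) :=
      ⟨Λ, dependsOn_boxTransfer_iterate β J 1 hf n⟩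
    rw [Function.iterate_succ_apply', Function.iterate_succ_apply']
    exact (transfer_le_transfer β J (IsLocal.transfer_iterate β J ⟨Λ, hf⟩ n) hl ih σ).trans
      (transfer_monotone hβ hJ (boxTransfer_iterate_monotone hβ hJ 1 hf hm n) hl
        (le_pin_plus Λ σ))

theorem boxTransfer_le_transfer_iterate {d : ℕ} {β : ℝ} (hβ : 0 < β) {J : Interaction d}
    (hJ : ∀ k, 0 ≤ J.K k) {Λ : Finset (Site d)} {f : Config d → ℝ}
    (hf : DependsOn f (Λ : Set (Site d))) (hm : Monotone f) (n : ℕ) (σ : Config d) :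
    (boxTransfer β J (-1) Λ)^[n] f σ ≤ (transfer β J)^[n] f σ := by
  induction n generalizing σ with
  | zero => exact le_refl (f σ)
  | succ n ih =>
    have hl : IsLocal ((boxTransfer β J (-1) Λ)^[n] f) :=
      ⟨Λ, dependsOn_boxTransfer_iterate β J (-1) hf n⟩
    rw [Function.iterate_succ_apply', Function.iterate_succ_apply']
    exact (transfer_monotone hβ hJ (boxTransfer_iterate_monotone hβ hJ (-1) hf hm n) hl
        (pin_minus_le Λ σ)).trans
      (transfer_le_transfer β J hl (IsLocal.transfer_iterate β J ⟨Λ, hf⟩ n) ih σ)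

/-- Contraction of the oscillation of monotone functions under the dynamics in a box. -/
theorem exists_boxTransfer_contraction {d : ℕ} {β : ℝ} (J : Interaction d) (s : Spin)
    (Λ : Finset (Site d)) :
    ∃ ε : ℝ, 0 < ε ∧ ε ≤ 1 ∧ ∀ g : Config d → ℝ, Monotone g → DependsOn g (Λ : Set (Site d)) →
      boxTransfer β J s Λ g (fun _ => 1) - boxTransfer β J s Λ g (fun _ => -1) ≤
        (1 - ε) * (g (fun _ => 1) - g fun _ => -1) := by
  set η := pin Λ (fun _ => s) fun _ => 1 with hη
  have hle : jumpProb β J Λ η (fun _ => -1) ≤ 1 := by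
    rw [← sum_jumpProb β J Λ η]
    exact Finset.single_le_sum (f := jumpProb β J Λ η) (fun ξ _ => (jumpProb_pos _ _ _ _ _).le)
      (Finset.mem_univ _)
  -- A Doeblin bound: ε is the probability that the box dynamics started from its top configuration
  -- jumps to all minus in Λ. It lowers the value at the top, while the value at the bottom cannot
  -- decrease.
  refine ⟨jumpProb β J Λ η fun _ => -1, jumpProb_pos _ _ _ _ _, hle, fun g hg hl => ?_⟩
  set ε := jumpProb β J Λ η fun _ => -1
  have h1 : boxTransfer β J s Λ g (fun _ => 1) ≤
      (1 - ε) * g (fun _ => 1) + ε * g (fun _ => -1) := by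
    rw [boxTransfer, ← hη, transfer_eq_sum β J hl (fun _ => -1)]
    rw [← sum_jumpProb β J Λ η, ← Finset.sum_erase_add _ _ (Finset.mem_univ fun _ => (-1 : Spin)),
      ← Finset.sum_erase_add (a := fun _ => (-1 : Spin)) Finset.univ (jumpProb β J Λ η)
        (Finset.mem_univ _), add_sub_cancel_right, Finset.sum_mul]
    refine add_le_add (Finset.sum_le_sum fun ξ _ => ?_) (le_of_eq ?_)
    · exact mul_le_mul_of_nonneg_left (hg (le_plus _)) (jumpProb_pos _ _ _ _ _).le
    · congr 2
      funext k
      by_cases hk : k ∈ Λ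
      · rw [glue_of_mem _ _ hk]
      · rw [glue_of_notMem _ _ hk]
  have h2 : g (fun _ => -1) ≤ boxTransfer β J s Λ g (fun _ => -1) := by
    rw [boxTransfer, transfer_eq_sum β J hl (fun _ => -1), ← one_mul (g fun _ => -1),
      ← sum_jumpProb β J Λ (pin Λ (fun _ => s) fun _ => -1), Finset.sum_mul]
    exact Finset.sum_le_sum fun ξ _ =>
      mul_le_mul_of_nonneg_left (hg (minus_le _)) (jumpProb_pos _ _ _ _ _).le
  linarith

/-- The iterate at σ and the invariant average both lie between the iterates at the two constant
configurations, whose gap contracts geometrically. -/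
theorem boxTransfer_iterate_tendsto {d : ℕ} {β : ℝ} (hβ : 0 < β) {J : Interaction d}
    (hJ : ∀ k, 0 ≤ J.K k) (s : Spin) {Λ : Finset (Site d)} {f : Config d → ℝ}
    (hf : DependsOn f (Λ : Set (Site d))) (hm : Monotone f) (σ : Config d) :
    Tendsto (fun n => (boxTransfer β J s Λ)^[n] f σ) atTop (𝓝 (boxAvg β J s Λ f)) := by
  obtain ⟨ε, hε, hε1, hc⟩ := exists_boxTransfer_contraction (β := β) J s Λ
  have hmono := boxTransfer_iterate_monotone hβ hJ s hf hm
  set D : ℕ → ℝ := fun n => (boxTransfer β J s Λ)^[n] f (fun _ => 1) -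
    (boxTransfer β J s Λ)^[n] f (fun _ => -1) with hD
  have hDle : ∀ n, D n ≤ (1 - ε) ^ n * D 0 := by
    intro n
    induction n with
    | zero => simp
    | succ n ih =>
      have := hc _ (hmono n) (dependsOn_boxTransfer_iterate β J s hf n)
      calc D (n + 1) ≤ (1 - ε) * D n := by
            simpa only [hD, Function.iterate_succ_apply'] using this
        _ ≤ (1 - ε) * ((1 - ε) ^ n * D 0) := mul_le_mul_of_nonneg_left ih (by linarith)
        _ = _ := by ring
  have hlim : Tendsto (fun n => (1 - ε) ^ n * D 0) atTop (𝓝 0) := by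
    simpa using (tendsto_pow_atTop_nhds_zero_of_lt_one (by linarith) (by linarith)).mul_const (D 0)
  rw [tendsto_iff_dist_tendsto_zero]
  refine squeeze_zero (fun _ => dist_nonneg) (fun n => ?_) hlim
  have h1 : boxAvg β J s Λ f ≤ (boxTransfer β J s Λ)^[n] f fun _ => 1 := by
    rw [← boxAvg_boxTransfer_iterate β J s hf n, ← blockAvg_const (boxWeight_pos β J s Λ)
      ((boxTransfer β J s Λ)^[n] f fun _ => 1)]
    exact blockAvg_mono (boxWeight_pos β J s Λ) fun ξ => hmono n (le_plus _)
  have h2 : (boxTransfer β J s Λ)^[n] f (fun _ => -1) ≤ boxAvg β J s Λ f := by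
    rw [← boxAvg_boxTransfer_iterate β J s hf n, ← blockAvg_const (boxWeight_pos β J s Λ)
      ((boxTransfer β J s Λ)^[n] f fun _ => -1)]
    exact blockAvg_mono (boxWeight_pos β J s Λ) fun ξ => hmono n (minus_le _)
  have h3 := hmono n (le_plus σ)
  have h4 := hmono n (minus_le σ)
  have h5 := hDle n
  rw [Real.dist_eq, abs_le]
  simp only [hD] at h5 ⊢
  constructor <;> linarith

/-! ## Translations -/

/-- The translate of a configuration. -/
def shift {d : ℕ} (a : Site d) (σ : Config d) : Config d := fun k => σ (k + a)

theorem updateRule_shift {d : ℕ} (β : ℝ) (J : Interaction d) (a k : Site d) (η : Config d) :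
    updateRule β J k (shift a η) = updateRule β J (k + a) η := by
  have e : ∀ s, updateProb β J k (shift a η) s = updateProb β J (k + a) η s := by
    intro s
    rw [updateProb, updateProb]
    congr 5
    rw [← (Equiv.addRight a).tsum_eq fun k' => J.K (k' - (k + a)) * spinVal (η k')]
    refine tsum_congr fun j => ?_
    simp [shift]
  simp only [updateRule, e]

theorem kernel_shift {d : ℕ} (β : ℝ) (J : Interaction d) (a : Site d) (η : Config d) :
    kernel β J (shift a η) = (kernel β J η).map (shift a) := by
  have h := Measure.infinitePi_map_piCongrLeft
    (μ := fun k : Site d => updateRule β J k (shift a η)) (Equiv.addRight (-a))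
  have e : ⇑(MeasurableEquiv.piCongrLeft (fun _ : Site d => Spin) (Equiv.addRight (-a))) =
      shift a := by
    funext σ k
    have := MeasurableEquiv.piCongrLeft_apply_apply (β := fun _ : Site d => Spin)
      (Equiv.addRight (-a)) σ (k + a)
    simpa [shift] using this
  rw [kernel_apply, ← h, kernel_apply, e]
  simp only [updateRule_shift, Equiv.coe_addRight, neg_add_cancel_right]

theorem transfer_shift {d : ℕ} (β : ℝ) (J : Interaction d) (a : Site d) {f : Config d → ℝ}
    (hf : Measurable f) (η : Config d) :
    transfer β J (fun σ => f (shift a σ)) η = transfer β J f (shift a η) := by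
  rw [transfer, transfer, kernel_shift, integral_map]
  · exact (measurable_pi_lambda _ fun k => measurable_pi_apply _).aemeasurable
  · exact hf.aestronglyMeasurable

/-! ## Local functions and measures -/

theorem IsLocal.continuous {d : ℕ} {f : Config d → ℝ} (hf : IsLocal f) : Continuous f := by
  obtain ⟨Λ, hΛ⟩ := hf
  have e : f = (fun ξ : Λ → Spin => f (glue Λ ξ fun _ => 1)) ∘ Λ.restrict :=
    funext fun σ => (apply_pin hΛ (fun _ => 1) σ).symm
  rw [e]
  exact continuous_of_discreteTopology.comp (Finset.continuous_restrict Λ)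

theorem IsLocal.measurable {d : ℕ} {f : Config d → ℝ} (hf : IsLocal f) : Measurable f :=
  hf.continuous.measurable

theorem IsLocal.exists_bound {d : ℕ} {f : Config d → ℝ} (hf : IsLocal f) :
    ∃ C, ∀ σ, |f σ| ≤ C := by
  obtain ⟨C, hC⟩ := isCompact_univ.exists_bound_of_continuousOn hf.continuous.continuousOn
  exact ⟨C, fun σ => hC σ (Set.mem_univ σ)⟩

theorem IsLocal.integrable {d : ℕ} {f : Config d → ℝ} (hf : IsLocal f) (μ : Measure (Config d))
    [IsFiniteMeasure μ] : Integrable f μ := by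
  obtain ⟨C, hC⟩ := hf.exists_bound
  exact .of_bound hf.measurable.aestronglyMeasurable C (.of_forall hC)

theorem IsLocal.add {d : ℕ} {f g : Config d → ℝ} (hf : IsLocal f) (hg : IsLocal g) :
    IsLocal fun σ => f σ + g σ := by
  obtain ⟨Λ, hΛ⟩ := hf
  obtain ⟨Δ, hΔ⟩ := hg
  refine ⟨Λ ∪ Δ, fun σ η h => ?_⟩
  simp only [Finset.coe_union] at h ⊢
  rw [hΛ fun i hi => h i (.inl hi), hΔ fun i hi => h i (.inr hi)]

theorem IsLocal.const_mul {d : ℕ} {f : Config d → ℝ} (hf : IsLocal f) (c : ℝ) :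
    IsLocal fun σ => c * f σ :=
  let ⟨Λ, hΛ⟩ := hf
  ⟨Λ, fun _ _ h => congrArg (c * ·) (hΛ h)⟩

theorem isLocal_const {d : ℕ} (c : ℝ) : IsLocal fun _ : Config d => c :=
  ⟨∅, fun _ _ _ => rfl⟩

theorem isLocal_spinVal {d : ℕ} (k : Site d) : IsLocal fun σ : Config d => spinVal (σ k) :=
  ⟨{k}, fun σ η h => congrArg spinVal (h k (by simp))⟩

theorem isLocal_finset_sum {d : ℕ} {ι : Type*} (s : Finset ι) {f : ι → Config d → ℝ}
    (hf : ∀ i ∈ s, IsLocal (f i)) : IsLocal fun σ => ∑ i ∈ s, f i σ := by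
  classical
  induction s using Finset.induction_on with
  | empty => simpa using isLocal_const (d := d) 0
  | insert a s ha ih =>
    simp only [Finset.sum_insert ha]
    exact (hf a (Finset.mem_insert_self a s)).add
      (ih fun i hi => hf i (Finset.mem_insert_of_mem hi))

/-- The event that all spins in `A` are `+1`. -/
def plusEvent {d : ℕ} (A : Finset (Site d)) : Set (Config d) := {σ | ∀ k ∈ A, σ k = 1}

theorem measurableSet_plusEvent {d : ℕ} (A : Finset (Site d)) : MeasurableSet (plusEvent A) := by
  have : plusEvent A = ⋂ k ∈ A, (fun σ : Config d => σ k) ⁻¹' {1} := by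
    ext σ; simp [plusEvent]
  rw [this]
  exact A.measurableSet_biInter fun k _ => measurable_pi_apply k (.of_discrete)

theorem monotone_indicator_plusEvent {d : ℕ} (A : Finset (Site d)) :
    Monotone ((plusEvent A).indicator fun _ => (1 : ℝ)) := by
  intro σ η h
  by_cases hσ : σ ∈ plusEvent A
  · have hη : η ∈ plusEvent A := fun k hk =>
      le_antisymm (spin_le_one _) ((hσ k hk).symm.le.trans (h k))
    simp [hσ, hη]
  · rw [Set.indicator_of_notMem hσ]
    exact Set.indicator_nonneg (fun _ _ => zero_le_one) _

theorem isLocal_indicator_plusEvent {d : ℕ} (A : Finset (Site d)) :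
    IsLocal ((plusEvent A).indicator fun _ => (1 : ℝ)) := by
  refine ⟨A, fun σ η h => ?_⟩
  have : σ ∈ plusEvent A ↔ η ∈ plusEvent A :=
    forall₂_congr fun k hk => by rw [h k hk]
  by_cases hσ : σ ∈ plusEvent A
  · simp [hσ, this.1 hσ]
  · rw [Set.indicator_of_notMem hσ, Set.indicator_of_notMem fun h => hσ (this.2 h)]

/-- With two spin values, the event of a minus is the complement of a plus event. The plus events
form a π-system with monotone local indicators, so monotone local functions determine a probability
measure. -/
theorem generateFrom_plusEvent {d : ℕ} :
    (MeasurableSpace.pi : MeasurableSpace (Config d)) =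
      MeasurableSpace.generateFrom (Set.range plusEvent) := by
  apply le_antisymm
  · refine iSup_le fun k => ?_
    rw [← measurable_iff_comap_le]
    refine @measurable_to_countable' _ _ _ _ (MeasurableSpace.generateFrom _) _ fun s => ?_
    have h1 : MeasurableSet[MeasurableSpace.generateFrom (Set.range (plusEvent (d := d)))]
        ((fun σ : Config d => σ k) ⁻¹' {1}) := by
      refine MeasurableSpace.measurableSet_generateFrom ⟨{k}, ?_⟩
      ext σ; simp [plusEvent]
    rcases Int.units_eq_one_or s with rfl | rfl
    · exact h1
    · have : (fun σ : Config d => σ k) ⁻¹' {-1} = ((fun σ : Config d => σ k) ⁻¹' {1})ᶜ := by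
        ext σ
        rcases Int.units_eq_one_or (σ k) with h | h <;> simp [h]
      rw [this]
      exact h1.compl
  · refine MeasurableSpace.generateFrom_le ?_
    rintro _ ⟨A, rfl⟩
    exact measurableSet_plusEvent A

theorem isPiSystem_plusEvent {d : ℕ} : IsPiSystem (Set.range (plusEvent (d := d))) := by
  rintro _ ⟨A, rfl⟩ _ ⟨B, rfl⟩ _
  refine ⟨A ∪ B, ?_⟩
  ext σ
  simp only [plusEvent, Finset.mem_union, Set.mem_ofPred_eq, Set.mem_inter_iff]
  exact ⟨fun h => ⟨fun k hk => h k (.inl hk), fun k hk => h k (.inr hk)⟩,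
    fun h k hk => hk.elim (h.1 k) (h.2 k)⟩

/-- Two probability measures are equal if they agree on monotone local functions. -/
theorem ext_of_monotone_local {d : ℕ} {μ ν : Measure (Config d)} [IsProbabilityMeasure μ]
    [IsProbabilityMeasure ν]
    (h : ∀ f : Config d → ℝ, Monotone f → IsLocal f → ∫ σ, f σ ∂μ = ∫ σ, f σ ∂ν) : μ = ν := by
  refine ext_of_generate_finite _ generateFrom_plusEvent isPiSystem_plusEvent ?_ (by simp)
  rintro _ ⟨A, rfl⟩
  have := h _ (monotone_indicator_plusEvent A) (isLocal_indicator_plusEvent A)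
  rw [integral_indicator_const _ (measurableSet_plusEvent A),
    integral_indicator_const _ (measurableSet_plusEvent A), smul_eq_mul, smul_eq_mul, mul_one,
    mul_one] at this
  exact (measureReal_eq_measureReal_iff).1 this

/-- Weak convergence of probability measures follows from convergence on monotone local
functions. -/
theorem tendsto_integral_of_monotone_local {d : ℕ} {m : ℕ → Measure (Config d)}
    {μ : Measure (Config d)} [hm : ∀ n, IsProbabilityMeasure (m n)] [hμ : IsProbabilityMeasure μ]
    (h : ∀ f : Config d → ℝ, Monotone f → IsLocal f →
      Tendsto (fun n => ∫ σ, f σ ∂(m n)) atTop (𝓝 (∫ σ, f σ ∂μ)))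
    (f : BoundedContinuousFunction (Config d) ℝ) :
    Tendsto (fun n => ∫ σ, f σ ∂(m n)) atTop (𝓝 (∫ σ, f σ ∂μ)) := by
  let M : ℕ → ProbabilityMeasure (Config d) := fun n => ⟨m n, hm n⟩
  let M' : ProbabilityMeasure (Config d) := ⟨μ, hμ⟩
  suffices H : Tendsto M atTop (𝓝 M') from
    ProbabilityMeasure.tendsto_iff_forall_integral_tendsto.1 H f
  -- The space of probability measures is compact, so every ultrafilter has a limit; its values on
  -- monotone local functions identify it as μ.
  rw [tendsto_iff_ultrafilter]
  intro U hU
  have hlim : Tendsto M U (𝓝 (U.map M).lim) := (U.map M).le_nhds_lim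
  have e : (U.map M).lim = M' := by
    refine Subtype.ext (ext_of_monotone_local (μ := ((U.map M).lim : Measure (Config d)))
      (ν := μ) fun g hg hl => ?_)
    have h1 := ProbabilityMeasure.tendsto_iff_forall_integral_tendsto.1 hlim
      (.mkOfCompact ⟨g, hl.continuous⟩)
    exact tendsto_nhds_unique h1 ((h g hg hl).mono_left hU)
  rwa [e] at hlim

/-! ### Stationarity and laws at time n, tested on local functions. -/

theorem integral_bind_kernel {d : ℕ} (κ : Kernel (Config d) (Config d)) [IsMarkovKernel κ]
    (μ : Measure (Config d)) [IsProbabilityMeasure μ] {f : Config d → ℝ} (hf : IsLocal f) :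
    ∫ σ, f σ ∂(μ.bind κ) = ∫ σ, ∫ ω, f ω ∂(κ σ) ∂μ := by
  have e : μ.bind κ = (κ ∘ₖ Kernel.const Unit μ) () := by
    rw [Kernel.comp_apply, Kernel.const_apply]
  rw [e, Kernel.integral_comp (hf.integrable _), Kernel.const_apply]

theorem invariant_iff {d : ℕ} (κ : Kernel (Config d) (Config d)) [IsMarkovKernel κ]
    (μ : Measure (Config d)) [IsProbabilityMeasure μ] :
    κ.Invariant μ ↔ ∀ f : Config d → ℝ, IsLocal f → ∫ σ, ∫ ω, f ω ∂(κ σ) ∂μ = ∫ σ, f σ ∂μ := by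
  constructor
  · intro h f hf
    rw [← integral_bind_kernel κ μ hf, h]
  · intro h
    have : IsProbabilityMeasure (μ.bind κ) := by infer_instance
    exact ext_of_monotone_local fun f _ hf => by rw [integral_bind_kernel κ μ hf, h f hf]

theorem isProbabilityMeasure_lawAt {d : ℕ} (κ : Kernel (Config d) (Config d)) [IsMarkovKernel κ]
    (ν : Measure (Config d)) [hν : IsProbabilityMeasure ν] (n : ℕ) :
    IsProbabilityMeasure (lawAt κ ν n) := by
  induction n with
  | zero => exact hν
  | succ n ih =>
    rw [lawAt]
    infer_instance

theorem integral_lawAt {d : ℕ} (β : ℝ) (J : Interaction d) (ν : Measure (Config d))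
    [IsProbabilityMeasure ν] {f : Config d → ℝ} (hf : IsLocal f) (n : ℕ) :
    ∫ σ, f σ ∂(lawAt (kernel β J) ν n) = ∫ σ, (transfer β J)^[n] f σ ∂ν := by
  -- The last step of the chain is the first to act on f, hence the generalisation.
  induction n generalizing f with
  | zero => rfl
  | succ n ih =>
    have := isProbabilityMeasure_lawAt (kernel β J) ν n
    rw [lawAt, integral_bind_kernel _ _ hf, Function.iterate_succ_apply]
    exact ih (hf.transfer β J)

/-! ## Block averages as measures -/

/-- The probability measure with expectation `f ↦ blockAvg Λ w f τ`. -/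
def blockMeasure {d : ℕ} (Λ : Finset (Site d)) (w : Config d → ℝ) (τ : Config d) :
    Measure (Config d) :=
  ∑ ξ : Λ → Spin, ENNReal.ofReal (w (glue Λ ξ τ) / blockSum Λ w τ) • Measure.dirac (glue Λ ξ τ)

theorem isProbabilityMeasure_blockMeasure {d : ℕ} (Λ : Finset (Site d)) {w : Config d → ℝ}
    (hw : ∀ σ, 0 < w σ) (τ : Config d) : IsProbabilityMeasure (blockMeasure Λ w τ) := by
  constructor
  simp only [blockMeasure, Measure.coe_finsetSum, Finset.sum_apply, Measure.smul_apply,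
    measure_univ, smul_eq_mul, mul_one]
  rw [← ENNReal.ofReal_sum_of_nonneg fun ξ _ => (div_pos (hw _) (blockSum_pos hw τ)).le,
    sum_blockAvg_weight hw, ENNReal.ofReal_one]

theorem integral_blockMeasure {d : ℕ} (Λ : Finset (Site d)) {w : Config d → ℝ}
    (hw : ∀ σ, 0 < w σ) (τ : Config d) {f : Config d → ℝ} (hf : IsLocal f) :
    ∫ σ, f σ ∂(blockMeasure Λ w τ) = blockAvg Λ w f τ := by
  rw [blockMeasure, integral_finsetSum_measure, blockAvg_eq_sum]
  · refine Finset.sum_congr rfl fun ξ _ => ?_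
    rw [integral_smul_measure, integral_dirac,
      ENNReal.toReal_ofReal (div_pos (hw _) (blockSum_pos hw τ)).le, smul_eq_mul]
  · intro ξ _
    exact (hf.integrable _).smul_measure ENNReal.ofReal_ne_top

/-! ### Block kernels as conditional laws. -/

theorem measurable_glue_cylinderEvents {d : ℕ} {Λ : Finset (Site d)} (ξ : Λ → Spin) :
    Measurable[cylinderEvents ((Λ : Set (Site d))ᶜ)] (glue Λ ξ : Config d → Config d) := by
  refine @measurable_pi_lambda _ _ _ (cylinderEvents _) _ _ fun k => ?_
  by_cases hk : k ∈ Λ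
  · simp only [glue_of_mem _ _ hk]
    exact @measurable_const _ _ _ (cylinderEvents _) _
  · simp only [glue_of_notMem _ _ hk]
    exact measurable_cylinderEvents_iff.1 (@measurable_id _ (cylinderEvents _)) (by simpa using hk)

theorem measurable_blockMeasure_apply {d : ℕ} (Λ : Finset (Site d)) {w : Config d → ℝ}
    (hw : Measurable w) {A : Set (Config d)} (hA : MeasurableSet A) :
    Measurable[cylinderEvents ((Λ : Set (Site d))ᶜ)] fun σ => blockMeasure Λ w σ A := by
  simp only [blockMeasure, Measure.coe_finsetSum, Finset.sum_apply, Measure.smul_apply,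
    smul_eq_mul, Measure.dirac_apply' _ hA, blockSum]
  have hi : Measurable (A.indicator (1 : Config d → ENNReal)) := measurable_one.indicator hA
  let _ : MeasurableSpace (Config d) := cylinderEvents ((Λ : Set (Site d))ᶜ)
  have h : ∀ ξ : Λ → Spin, Measurable[cylinderEvents ((Λ : Set (Site d))ᶜ)]
      fun σ => w (glue Λ ξ σ) := fun ξ => hw.comp (measurable_glue_cylinderEvents ξ)
  refine Finset.measurable_sum _ fun ξ _ => ?_
  refine ((h ξ).div (Finset.measurable_sum _ fun ζ _ => h ζ)).ennreal_ofReal.mul ?_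
  exact hi.comp (measurable_glue_cylinderEvents ξ)

/-- The kernel `τ ↦ blockMeasure Λ w τ`. -/
def blockKernel {d : ℕ} (Λ : Finset (Site d)) {w : Config d → ℝ} (hw : Measurable w) :
    Kernel (Config d) (Config d) where
  toFun := blockMeasure Λ w
  measurable' := Measure.measurable_of_measurable_coe _ fun _ hA =>
    (measurable_blockMeasure_apply Λ hw hA).mono cylinderEvents_le_pi le_rfl

/-- Overwriting the spins of Λ by a fixed pattern leaves the coordinates off Λ unchanged, so it
pulls back enough events to generate the exterior σ-algebra. Hence such events ignore the spins of
Λ. -/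
theorem exists_preimage_glue {d : ℕ} {Λ : Finset (Site d)} {B : Set (Config d)}
    (hB : MeasurableSet[cylinderEvents ((Λ : Set (Site d))ᶜ)] B) :
    ∃ B' : Set (Config d), B = glue Λ (fun _ => 1) ⁻¹' B' := by
  have h : cylinderEvents ((Λ : Set (Site d))ᶜ) ≤
      MeasurableSpace.comap (glue Λ (fun _ => 1) : Config d → Config d) MeasurableSpace.pi := by
    refine iSup₂_le fun k hk => ?_
    have e : (fun σ : Config d => σ k) = (fun σ => σ k) ∘ glue Λ (fun _ => 1) := by
      funext σ
      exact (glue_of_notMem (fun _ => 1) σ (by simpa using hk)).symm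
    rw [e, ← MeasurableSpace.comap_comp]
    exact MeasurableSpace.comap_mono (measurable_pi_apply k).comap_le
  obtain ⟨B', -, hB'⟩ := h B hB
  exact ⟨B', hB'.symm⟩

theorem glue_mem_iff {d : ℕ} {Λ : Finset (Site d)} {B : Set (Config d)}
    (hB : MeasurableSet[cylinderEvents ((Λ : Set (Site d))ᶜ)] B) (ξ : Λ → Spin) (σ : Config d) :
    glue Λ ξ σ ∈ B ↔ σ ∈ B := by
  obtain ⟨B', rfl⟩ := exists_preimage_glue hB
  rw [Set.mem_preimage, Set.mem_preimage, glue_congr _ fun k hk => glue_of_notMem _ _ hk]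

/-- Properness of the kernel: it resamples only the spins of Λ, so an exterior event acts as a
constant. This is what turns invariance into a conditional expectation. -/
theorem blockMeasure_inter {d : ℕ} {Λ : Finset (Site d)} {w : Config d → ℝ}
    {A B : Set (Config d)} (hA : MeasurableSet A)
    (hB : MeasurableSet[cylinderEvents ((Λ : Set (Site d))ᶜ)] B) (σ : Config d) :
    blockMeasure Λ w σ (B ∩ A) = B.indicator (fun σ => blockMeasure Λ w σ A) σ := by
  have hB' : MeasurableSet B := cylinderEvents_le_pi B hB
  by_cases hσ : σ ∈ B
  · rw [Set.indicator_of_mem hσ]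
    simp only [blockMeasure, Measure.coe_finsetSum, Finset.sum_apply, Measure.smul_apply,
      smul_eq_mul, Measure.dirac_apply' _ hA, Measure.dirac_apply' _ (hB'.inter hA)]
    refine Finset.sum_congr rfl fun ξ _ => ?_
    congr 1
    have hξ : glue Λ ξ σ ∈ B := (glue_mem_iff hB ξ σ).2 hσ
    by_cases hξA : glue Λ ξ σ ∈ A
    · rw [Set.indicator_of_mem hξA, Set.indicator_of_mem (Set.mem_inter hξ hξA)]
    · rw [Set.indicator_of_notMem hξA, Set.indicator_of_notMem fun h => hξA h.2]
  · rw [Set.indicator_of_notMem hσ]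
    simp only [blockMeasure, Measure.coe_finsetSum, Finset.sum_apply, Measure.smul_apply,
      smul_eq_mul, Measure.dirac_apply' _ (hB'.inter hA)]
    refine Finset.sum_eq_zero fun ξ _ => ?_
    simp [Set.indicator, glue_mem_iff hB, hσ]

/-- A block kernel is a regular conditional probability if and only if it leaves the measure
invariant. -/
theorem condExp_eq_blockMeasure_iff {d : ℕ} (Λ : Finset (Site d)) {w : Config d → ℝ}
    (hw : ∀ σ, 0 < w σ) (hm : Measurable w) (μ : Measure (Config d)) [IsProbabilityMeasure μ] :
    (∀ A : Set (Config d), MeasurableSet A →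
      μ⟦A | cylinderEvents ((Λ : Set (Site d))ᶜ)⟧ =ᵐ[μ] fun σ => (blockMeasure Λ w σ).real A) ↔
    (blockKernel Λ hm).Invariant μ := by
  have hp := isProbabilityMeasure_blockMeasure Λ hw
  have hle : cylinderEvents ((Λ : Set (Site d))ᶜ) ≤
    (MeasurableSpace.pi : MeasurableSpace (Config d)) := cylinderEvents_le_pi
  have hmeas : ∀ A : Set (Config d), MeasurableSet A → Measurable fun σ => blockMeasure Λ w σ A :=
    fun A hA => (measurable_blockMeasure_apply Λ hm hA).mono hle le_rfl
  have hint : ∀ A : Set (Config d), MeasurableSet A →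
      Integrable (fun σ => (blockMeasure Λ w σ).real A) μ := fun A hA =>
    .of_bound (hmeas A hA).ennreal_toReal.aestronglyMeasurable 1 (.of_forall fun σ => by
      rw [Real.norm_of_nonneg measureReal_nonneg]; exact measureReal_le_one)
  have hbind : ∀ A : Set (Config d), MeasurableSet A →
      (μ.bind (blockKernel Λ hm)).real A = ∫ σ, (blockMeasure Λ w σ).real A ∂μ := by
    intro A hA
    rw [Measure.real, Measure.bind_apply hA (Kernel.aemeasurable _), ← integral_toReal]
    · rfl
    · exact (hmeas A hA).aemeasurable
    · exact .of_forall fun σ => measure_lt_top (blockMeasure Λ w σ) A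
  have hmk : IsMarkovKernel (blockKernel Λ hm) := ⟨hp⟩
  constructor
  · intro h
    have : IsProbabilityMeasure (μ.bind (blockKernel Λ hm)) := by infer_instance
    refine Measure.ext fun A hA => (measureReal_eq_measureReal_iff).1 ?_
    rw [hbind A hA, ← integral_congr_ae (h A hA), integral_condExp hle,
      integral_indicator_const _ hA, smul_eq_mul, mul_one]
  · intro h A hA
    refine (ae_eq_condExp_of_forall_setIntegral_eq hle ?_ ?_ ?_ ?_).symm
    · exact (integrable_const _).indicator hA
    · exact fun s _ _ => (hint A hA).integrableOn
    -- Invariance is tested on B ∩ A, and properness then restricts the integral to B.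
    · intro B hB _
      have hB' := hle B hB
      have e : μ.real (B ∩ A) = ∫ σ, (blockMeasure Λ w σ).real (B ∩ A) ∂μ := by
        rw [← hbind _ (hB'.inter hA), show μ.bind (blockKernel Λ hm) = μ from h]
      rw [setIntegral_indicator hA, setIntegral_const, smul_eq_mul, mul_one,
        ← integral_indicator hB', e]
      refine integral_congr_ae (.of_forall fun σ => ?_)
      simp only [Measure.real]
      rw [blockMeasure_inter hA hB]
      by_cases hσ : σ ∈ B <;> simp [hσ]
    · exact (measurable_blockMeasure_apply Λ hm hA).ennreal_toReal.aestronglyMeasurable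

/-! ## The potential of the dynamics -/

/-- The neighbourhoods are translates of one finite set up to reflection. Adding up the sites of one
gives its cardinality times k minus a constant, which recovers k when the set is nonempty. -/
theorem nbhd_injective {d : ℕ} {J : Interaction d} {k l : Site d} (h : nbhd J k = nbhd J l)
    (hne : (nbhd J k).Nonempty) : k = l := by
  have e : ∀ k, nbhd J k = J.finite_support.toFinset.image (k - ·) := by
    intro k
    ext j
    simp only [mem_nbhd, Finset.mem_image, Set.Finite.mem_toFinset, Set.mem_ofPred_eq]
    exact ⟨fun hj => ⟨k - j, hj, sub_sub_cancel k j⟩, by rintro ⟨i, hi, rfl⟩; simpa using hi⟩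
  have hs : ∀ k, ∑ j ∈ nbhd J k, j =
      J.finite_support.toFinset.card • k - ∑ i ∈ J.finite_support.toFinset, i := by
    intro k
    rw [e, Finset.sum_image fun a _ b _ hab => sub_right_injective hab, Finset.sum_sub_distrib,
      Finset.sum_const]
  have hc : J.finite_support.toFinset.card ≠ 0 := by
    rw [e, Finset.image_nonempty] at hne
    exact Finset.card_ne_zero.2 hne
  have h2 := hs k
  rw [h, hs l, sub_left_inj] at h2
  funext i
  have h3 := congrFun h2 i
  simp only [Pi.smul_apply, nsmul_eq_mul] at h3
  exact (mul_left_cancel₀ (Nat.cast_ne_zero.2 hc) h3).symm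

theorem coe_nbhd {d : ℕ} (J : Interaction d) (k : Site d) :
    (nbhd J k : Set (Site d)) = {j | J.K (k - j) ≠ 0} := by
  ext j
  simp [mem_nbhd]

theorem potential_nbhd {d : ℕ} (β : ℝ) (J : Interaction d) {k : Site d}
    (hne : (nbhd J k).Nonempty) (σ : Config d) :
    potential β J (nbhd J k) σ = -Real.log (Real.cosh (field β J k σ)) := by
  have h : ∃ l : Site d, (nbhd J k : Set (Site d)) = {j | J.K (l - j) ≠ 0} := ⟨k, coe_nbhd J k⟩
  have hk : h.choose = k := by
    have := h.choose_spec
    rw [← coe_nbhd, Finset.coe_inj] at this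
    exact (nbhd_injective this hne).symm
  rw [potential, dif_pos h, hk, field]

theorem potential_eq_zero {d : ℕ} (β : ℝ) (J : Interaction d) {A : Finset (Site d)}
    (h : ∀ k, A ≠ nbhd J k) (σ : Config d) : potential β J A σ = 0 := by
  rw [potential, dif_neg]
  rintro ⟨k, hk⟩
  rw [← coe_nbhd, Finset.coe_inj] at hk
  exact h k hk

/-- The sets carrying φ and meeting Λ are the neighbourhoods of the sites of `nbhdSet J Λ`, each
counted once by injectivity; exponentiating turns log cosh into the factors of the weight. -/
theorem exp_neg_hamiltonian {d : ℕ} (β : ℝ) (J : Interaction d) (Λ : Finset (Site d))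
    (σ : Config d) :
    Real.exp (-hamiltonian (potential β J) Λ σ) = gibbsWeight β J Λ σ := by
  classical
  have hne : ∀ k ∈ nbhdSet J Λ, (nbhd J k ∩ Λ).Nonempty := by
    intro k hk
    obtain ⟨j, hj, hK⟩ := mem_nbhdSet.1 hk
    exact ⟨j, Finset.mem_inter.2 ⟨mem_nbhd.2 hK, hj⟩⟩
  have h : hamiltonian (potential β J) Λ σ =
      ∑ k ∈ nbhdSet J Λ, -Real.log (Real.cosh (field β J k σ)) := by
    rw [hamiltonian, tsum_eq_sum (s := (nbhdSet J Λ).image (nbhd J)), Finset.sum_image]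
    · refine Finset.sum_congr rfl fun k hk => ?_
      have := hne k hk
      rw [if_pos (by convert! this), potential_nbhd β J (this.mono Finset.inter_subset_left)]
    · exact fun k hk l _ hkl =>
        nbhd_injective hkl ((hne k hk).mono Finset.inter_subset_left)
    · intro A hA
      split_ifs with hAΛ
      · refine potential_eq_zero β J (fun k hk => hA ?_) σ
        obtain ⟨j, hj⟩ := hAΛ
        obtain ⟨hj, hj'⟩ := Finset.mem_inter.1 hj
        rw [hk] at hj
        exact Finset.mem_image.2 ⟨k, mem_nbhdSet.2 ⟨j, hj', mem_nbhd.1 hj⟩, hk.symm⟩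
      · rfl
  rw [h, Finset.sum_neg_distrib, neg_neg, Real.exp_sum, gibbsWeight]
  exact Finset.prod_congr rfl fun k _ => Real.exp_log (Real.cosh_pos _)

theorem finiteGibbs_eq {d : ℕ} (β : ℝ) (J : Interaction d) (Λ : Finset (Site d)) :
    finiteGibbs (potential β J) Λ = blockMeasure Λ (gibbsWeight β J Λ) := by
  funext τ
  simp only [finiteGibbs, partitionFn, exp_neg_hamiltonian]
  rfl

theorem isLocal_gibbsWeight {d : ℕ} (β : ℝ) (J : Interaction d) (Λ : Finset (Site d)) :
    IsLocal (gibbsWeight β J Λ) := by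
  refine ⟨nbhdSet J (nbhdSet J Λ), fun σ η h => Finset.prod_congr rfl fun k hk => ?_⟩
  rw [dependsOn_field β J k fun j hj => h j (nbhd_subset_nbhdSet hk hj)]

theorem isLocal_gibbsAvg {d : ℕ} (β : ℝ) (J : Interaction d) (Λ : Finset (Site d))
    {f : Config d → ℝ} (hf : IsLocal f) : IsLocal (gibbsAvg β J Λ f) := by
  obtain ⟨V, hV⟩ := isLocal_gibbsWeight β J Λ
  obtain ⟨W, hW⟩ := hf
  exact ⟨V ∪ W, dependsOn_blockAvg (hV.mono (by simp)) (hW.mono (by simp))⟩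

theorem integral_finiteGibbs {d : ℕ} (β : ℝ) (J : Interaction d) (Λ : Finset (Site d))
    (τ : Config d) {f : Config d → ℝ} (hf : IsLocal f) :
    ∫ σ, f σ ∂(finiteGibbs (potential β J) Λ τ) = gibbsAvg β J Λ f τ := by
  rw [finiteGibbs_eq, integral_blockMeasure Λ (gibbsWeight_pos β J Λ) τ hf, gibbsAvg]

/-- The Gibbs measures are the probability measures that are invariant under the averages of the
Gibbs specification. -/
theorem mem_gibbsMeasures_iff {d : ℕ} (β : ℝ) (J : Interaction d) (μ : Measure (Config d))
    [hμ : IsProbabilityMeasure μ] :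
    μ ∈ gibbsMeasures (potential β J) ↔ ∀ (Λ : Finset (Site d)) (f : Config d → ℝ), IsLocal f →
      ∫ σ, gibbsAvg β J Λ f σ ∂μ = ∫ σ, f σ ∂μ := by
  have key : ∀ Λ : Finset (Site d), (∀ A : Set (Config d), MeasurableSet A →
      μ⟦A | cylinderEvents ((Λ : Set (Site d))ᶜ)⟧ =ᵐ[μ]
        fun σ => (finiteGibbs (potential β J) Λ σ).real A) ↔
      ∀ f : Config d → ℝ, IsLocal f → ∫ σ, gibbsAvg β J Λ f σ ∂μ = ∫ σ, f σ ∂μ := by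
    intro Λ
    rw [finiteGibbs_eq, condExp_eq_blockMeasure_iff Λ (gibbsWeight_pos β J Λ)
      (isLocal_gibbsWeight β J Λ).measurable]
    have : IsMarkovKernel (blockKernel Λ (isLocal_gibbsWeight β J Λ).measurable) :=
      ⟨isProbabilityMeasure_blockMeasure Λ (gibbsWeight_pos β J Λ)⟩
    rw [invariant_iff]
    refine forall₂_congr fun f hf => ?_
    have e : ∀ σ, ∫ ω, f ω ∂(blockKernel Λ (isLocal_gibbsWeight β J Λ).measurable σ) =
        gibbsAvg β J Λ f σ := fun σ =>
      integral_blockMeasure Λ (gibbsWeight_pos β J Λ) σ hf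
    simp only [e]
  simp only [gibbsMeasures, Set.mem_ofPred_eq, hμ, true_and, key]

/-! ## Extremal Gibbs measures -/

theorem mem_ball {d L : ℕ} {k : Site d} : k ∈ ball d L ↔ siteNorm k ≤ L := by
  simp [ball]

theorem ball_mono {d : ℕ} : Monotone (ball d) := fun _ _ h _ hk =>
  mem_ball.2 ((mem_ball.1 hk).trans h)

theorem exists_subset_ball {d : ℕ} (Λ : Finset (Site d)) : ∃ L, Λ ⊆ ball d L :=
  ⟨Λ.sup siteNorm, fun _ hk => mem_ball.2 (Finset.le_sup (f := siteNorm) hk)⟩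

theorem eventually_subset_ball {d : ℕ} (Λ : Finset (Site d)) : ∀ᶠ L in atTop, Λ ⊆ ball d L :=
  let ⟨L, hL⟩ := exists_subset_ball Λ
  eventually_atTop.2 ⟨L, fun _ h => hL.trans (ball_mono h)⟩

/-- The reversible measures in the balls, with boundary condition `s`, have a limit point. -/
theorem exists_boxLimit {d : ℕ} (β : ℝ) (J : Interaction d) (s : Spin) :
    ∃ ρ : Measure (Config d), IsProbabilityMeasure ρ ∧ ∀ f : Config d → ℝ, IsLocal f →
      Tendsto (fun L => boxAvg β J s (ball d L) f) (hyperfilter ℕ) (𝓝 (∫ σ, f σ ∂ρ)) := by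
  let M : ℕ → ProbabilityMeasure (Config d) := fun L =>
    ⟨blockMeasure (ball d L) (boxWeight β J s (ball d L)) fun _ => s,
      isProbabilityMeasure_blockMeasure _ (boxWeight_pos β J s _) _⟩
  -- One ultrafilter serves all local functions at once, so compactness suffices and monotonicity of
  -- the box averages in L is not needed.
  have hlim : Tendsto M (hyperfilter ℕ) (𝓝 ((hyperfilter ℕ).map M).lim) :=
    ((hyperfilter ℕ).map M).le_nhds_lim
  refine ⟨((hyperfilter ℕ).map M).lim, inferInstance, fun f hf => ?_⟩
  have h1 := ProbabilityMeasure.tendsto_iff_forall_integral_tendsto.1 hlim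
    (.mkOfCompact ⟨f, hf.continuous⟩)
  refine h1.congr fun L => ?_
  exact integral_blockMeasure _ (boxWeight_pos β J s _) _ hf

/-- A limit along an ultrafilter of the reversible measures in the balls, with boundary
condition `s`. -/
def extremal {d : ℕ} (β : ℝ) (J : Interaction d) (s : Spin) : Measure (Config d) :=
  (exists_boxLimit β J s).choose

instance instProbExtremal {d : ℕ} (β : ℝ) (J : Interaction d) (s : Spin) :
    IsProbabilityMeasure (extremal β J s) :=
  (exists_boxLimit β J s).choose_spec.1

theorem tendsto_boxAvg {d : ℕ} (β : ℝ) (J : Interaction d) (s : Spin) {f : Config d → ℝ}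
    (hf : IsLocal f) :
    Tendsto (fun L => boxAvg β J s (ball d L) f) (hyperfilter ℕ)
      (𝓝 (∫ σ, f σ ∂(extremal β J s))) :=
  (exists_boxLimit β J s).choose_spec.2 f hf

/-- Identities valid in all large balls pass to the limit; both stationarity and the Gibbs property
are obtained in this way. -/
theorem integral_extremal_congr {d : ℕ} (β : ℝ) (J : Interaction d) (s : Spin)
    {f g : Config d → ℝ} (hf : IsLocal f) (hg : IsLocal g)
    (h : ∀ᶠ L in atTop, boxAvg β J s (ball d L) f = boxAvg β J s (ball d L) g) :
    ∫ σ, f σ ∂(extremal β J s) = ∫ σ, g σ ∂(extremal β J s) :=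
  tendsto_nhds_unique ((tendsto_boxAvg β J s hf).congr' (Nat.hyperfilter_le_atTop h))
    (tendsto_boxAvg β J s hg)

theorem integral_transfer_extremal {d : ℕ} (β : ℝ) (J : Interaction d) (s : Spin)
    {f : Config d → ℝ} (hf : IsLocal f) :
    ∫ σ, transfer β J f σ ∂(extremal β J s) = ∫ σ, f σ ∂(extremal β J s) := by
  obtain ⟨Λ, hΛ⟩ := hf
  refine integral_extremal_congr β J s (IsLocal.transfer β J ⟨Λ, hΛ⟩) ⟨Λ, hΛ⟩ ?_
  filter_upwards [eventually_subset_ball Λ] with L hL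
  exact boxAvg_transfer β J s (hΛ.mono hL)

theorem invariant_extremal {d : ℕ} (β : ℝ) (J : Interaction d) (s : Spin) :
    (kernel β J).Invariant (extremal β J s) :=
  (invariant_iff _ _).2 fun _ hf => integral_transfer_extremal β J s hf

theorem extremal_mem_gibbsMeasures {d : ℕ} (β : ℝ) (J : Interaction d) (s : Spin) :
    extremal β J s ∈ gibbsMeasures (potential β J) := by
  refine (mem_gibbsMeasures_iff β J _).2 fun Λ f hf =>
    integral_extremal_congr β J s (isLocal_gibbsAvg β J Λ hf) hf ?_
  filter_upwards [eventually_subset_ball Λ, eventually_subset_ball (nbhdSet J Λ)] with L h h'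
  exact boxAvg_gibbsAvg β J s h h' f

/-- The Gibbs property writes the expectation as an average of `gibbsAvg` over the boundary
condition, and the box averages bound that uniformly. -/
theorem gibbs_le_boxAvg {d : ℕ} {β : ℝ} (hβ : 0 < β) {J : Interaction d}
    (hJ : ∀ k, 0 ≤ J.K k) {μ : Measure (Config d)} (hμ : μ ∈ gibbsMeasures (potential β J))
    (Λ : Finset (Site d)) {f : Config d → ℝ} (hf : Monotone f) (hl : IsLocal f) :
    boxAvg β J (-1) Λ f ≤ ∫ σ, f σ ∂μ ∧ ∫ σ, f σ ∂μ ≤ boxAvg β J 1 Λ f := by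
  have hp : IsProbabilityMeasure μ := hμ.1
  rw [← (mem_gibbsMeasures_iff β J μ).1 hμ Λ f hl]
  have hi := (isLocal_gibbsAvg β J Λ hl).integrable μ
  constructor
  · have := integral_mono (integrable_const _) hi
      fun σ => boxAvg_le_gibbsAvg hβ hJ Λ hf σ
    simpa using this
  · have := integral_mono hi (integrable_const _)
      fun σ => gibbsAvg_le_boxAvg hβ hJ Λ hf σ
    simpa using this

theorem gibbs_le_extremal {d : ℕ} {β : ℝ} (hβ : 0 < β) {J : Interaction d}
    (hJ : ∀ k, 0 ≤ J.K k) {μ : Measure (Config d)} (hμ : μ ∈ gibbsMeasures (potential β J))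
    {f : Config d → ℝ} (hf : Monotone f) (hl : IsLocal f) :
    ∫ σ, f σ ∂(extremal β J (-1)) ≤ ∫ σ, f σ ∂μ ∧
      ∫ σ, f σ ∂μ ≤ ∫ σ, f σ ∂(extremal β J 1) :=
  ⟨le_of_tendsto' (tendsto_boxAvg β J (-1) hl) fun _ => (gibbs_le_boxAvg hβ hJ hμ _ hf hl).1,
    ge_of_tendsto' (tendsto_boxAvg β J 1 hl) fun _ => (gibbs_le_boxAvg hβ hJ hμ _ hf hl).2⟩

theorem gibbs_eq_of_extremal_eq {d : ℕ} {β : ℝ} (hβ : 0 < β) {J : Interaction d}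
    (hJ : ∀ k, 0 ≤ J.K k) (h : extremal β J (-1) = extremal β J 1) {μ : Measure (Config d)}
    (hμ : μ ∈ gibbsMeasures (potential β J)) : μ = extremal β J 1 := by
  have hp : IsProbabilityMeasure μ := hμ.1
  refine ext_of_monotone_local fun f hf hl => ?_
  have := gibbs_le_extremal hβ hJ hμ hf hl
  rw [h] at this
  exact le_antisymm this.2 this.1

/-- Both extremal measures are stationary, so ergodicity makes them equal; every Gibbs measure is
squeezed between them. -/
theorem not_phaseTransition_of_isErgodic {d : ℕ} {β : ℝ} (hβ : 0 < β) {J : Interaction d}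
    (hJ : ∀ k, 0 ≤ J.K k) (h : IsErgodic (kernel β J)) : ¬ PhaseTransition (potential β J) := by
  obtain ⟨μ, hμ⟩ := h
  have e : ∀ s, extremal β J s = μ := fun s =>
    hμ.unique _ inferInstance (invariant_extremal β J s)
  rw [PhaseTransition, not_lt, Set.encard_le_one_iff]
  intro ν ν' hν hν'
  have he : extremal β J (-1) = extremal β J 1 := by rw [e, e]
  rw [gibbs_eq_of_extremal_eq hβ hJ he hν, gibbs_eq_of_extremal_eq hβ hJ he hν']

theorem gibbsMeasures_eq_singleton {d : ℕ} (β : ℝ) (J : Interaction d)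
    (h : ¬ PhaseTransition (potential β J)) (s : Spin) :
    gibbsMeasures (potential β J) = {extremal β J s} := by
  rw [PhaseTransition, not_lt, Set.encard_le_one_iff] at h
  exact Set.eq_singleton_iff_unique_mem.2 ⟨extremal_mem_gibbsMeasures β J s,
    fun ν hν => h _ _ hν (extremal_mem_gibbsMeasures β J s)⟩

/-! ## Convergence of the dynamics -/

theorem integral_transfer_iterate {d : ℕ} {β : ℝ} {J : Interaction d} {μ : Measure (Config d)}
    [IsProbabilityMeasure μ] (h : (kernel β J).Invariant μ) {f : Config d → ℝ} (hf : IsLocal f)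
    (n : ℕ) : ∫ σ, (transfer β J)^[n] f σ ∂μ = ∫ σ, f σ ∂μ := by
  induction n with
  | zero => rfl
  | succ n ih =>
    rw [Function.iterate_succ_apply', ← ih]
    exact (invariant_iff _ μ).1 h _ (hf.transfer_iterate β J n)

theorem integral_le_transfer_iterate_plus {d : ℕ} {β : ℝ} (hβ : 0 < β) {J : Interaction d}
    (hJ : ∀ k, 0 ≤ J.K k) (ν : Measure (Config d)) [IsProbabilityMeasure ν] {f : Config d → ℝ}
    (hf : Monotone f) (hl : IsLocal f) (n : ℕ) :
    ∫ σ, (transfer β J)^[n] f σ ∂ν ≤ (transfer β J)^[n] f fun _ => 1 := by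
  obtain ⟨hm, hl'⟩ := transfer_iterate_monotone_local hβ hJ hf hl n
  have := integral_mono (hl'.integrable ν) (integrable_const _) fun σ => hm (le_plus σ)
  simpa using this

theorem transfer_iterate_minus_le_integral {d : ℕ} {β : ℝ} (hβ : 0 < β) {J : Interaction d}
    (hJ : ∀ k, 0 ≤ J.K k) (ν : Measure (Config d)) [IsProbabilityMeasure ν] {f : Config d → ℝ}
    (hf : Monotone f) (hl : IsLocal f) (n : ℕ) :
    (transfer β J)^[n] f (fun _ => -1) ≤ ∫ σ, (transfer β J)^[n] f σ ∂ν := by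
  obtain ⟨hm, hl'⟩ := transfer_iterate_monotone_local hβ hJ hf hl n
  have := integral_mono (integrable_const _) (hl'.integrable ν) fun σ => hm (minus_le σ)
  simpa using this

/-- From below, stationarity of the limit measure and maximality of the all-plus start. From above,
a ball with box average close to its limit is fixed first, and only then does n grow. -/
theorem tendsto_transfer_iterate_plus {d : ℕ} {β : ℝ} (hβ : 0 < β) {J : Interaction d}
    (hJ : ∀ k, 0 ≤ J.K k) {f : Config d → ℝ} (hf : Monotone f) (hl : IsLocal f) :
    Tendsto (fun n => (transfer β J)^[n] f fun _ => 1) atTop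
      (𝓝 (∫ σ, f σ ∂(extremal β J 1))) := by
  refine tendsto_order.2 ⟨fun a ha => .of_forall fun n => ha.trans_le ?_, fun a ha => ?_⟩
  · rw [← integral_transfer_iterate (invariant_extremal β J 1) hl n]
    exact integral_le_transfer_iterate_plus hβ hJ _ hf hl n
  · obtain ⟨Λ, hΛ⟩ := hl
    obtain ⟨L, hL, hL'⟩ := (((tendsto_boxAvg β J 1 ⟨Λ, hΛ⟩).eventually_lt_const ha).and
      (Nat.hyperfilter_le_atTop (eventually_subset_ball Λ))).exists
    have hb := boxTransfer_iterate_tendsto hβ hJ 1 (hΛ.mono hL') hf fun _ => 1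
    filter_upwards [hb.eventually_lt_const hL] with n hn
    exact (transfer_iterate_le_boxTransfer hβ hJ (hΛ.mono hL') hf n _).trans_lt hn

theorem tendsto_transfer_iterate_minus {d : ℕ} {β : ℝ} (hβ : 0 < β) {J : Interaction d}
    (hJ : ∀ k, 0 ≤ J.K k) {f : Config d → ℝ} (hf : Monotone f) (hl : IsLocal f) :
    Tendsto (fun n => (transfer β J)^[n] f fun _ => -1) atTop
      (𝓝 (∫ σ, f σ ∂(extremal β J (-1)))) := by
  refine tendsto_order.2 ⟨fun a ha => ?_, fun a ha => .of_forall fun n => lt_of_le_of_lt ?_ ha⟩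
  · obtain ⟨Λ, hΛ⟩ := hl
    obtain ⟨L, hL, hL'⟩ := (((tendsto_boxAvg β J (-1) ⟨Λ, hΛ⟩).eventually_const_lt ha).and
      (Nat.hyperfilter_le_atTop (eventually_subset_ball Λ))).exists
    have hb := boxTransfer_iterate_tendsto hβ hJ (-1) (hΛ.mono hL') hf fun _ => -1
    filter_upwards [hb.eventually_const_lt hL] with n hn
    exact hn.trans_le (boxTransfer_le_transfer_iterate hβ hJ (hΛ.mono hL') hf n _)
  · rw [← integral_transfer_iterate (invariant_extremal β J (-1)) hl n]
    exact transfer_iterate_minus_le_integral hβ hJ _ hf hl n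

theorem lawAt_eq_self {d : ℕ} {P : Kernel (Config d) (Config d)} {ν : Measure (Config d)}
    (h : P.Invariant ν) (n : ℕ) : lawAt P ν n = ν := by
  induction n with
  | zero => rfl
  | succ n ih => rw [lawAt, ih]; exact h

theorem isErgodicTowards_of_extremal_eq {d : ℕ} {β : ℝ} (hβ : 0 < β) {J : Interaction d}
    (hJ : ∀ k, 0 ≤ J.K k) (h : extremal β J (-1) = extremal β J 1) :
    IsErgodicTowards (kernel β J) (extremal β J 1) := by
  have hlim : ∀ ν : Measure (Config d), IsProbabilityMeasure ν → ∀ f : Config d → ℝ, Monotone f →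
      IsLocal f → Tendsto (fun n => ∫ σ, f σ ∂(lawAt (kernel β J) ν n)) atTop
        (𝓝 (∫ σ, f σ ∂(extremal β J 1))) := by
    intro ν hν f hf hl
    have h1 := tendsto_transfer_iterate_minus hβ hJ hf hl
    rw [h] at h1
    simp only [integral_lawAt β J ν hl]
    exact tendsto_of_tendsto_of_tendsto_of_le_of_le h1
      (tendsto_transfer_iterate_plus hβ hJ hf hl)
      (fun n => transfer_iterate_minus_le_integral hβ hJ ν hf hl n)
      (fun n => integral_le_transfer_iterate_plus hβ hJ ν hf hl n)
  refine ⟨inferInstance, invariant_extremal β J 1, fun ν hν hinv => ?_, fun ν hν f => ?_⟩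
  · refine ext_of_monotone_local fun f hf hl => ?_
    have := hlim ν hν f hf hl
    simp only [lawAt_eq_self hinv] at this
    exact tendsto_nhds_unique tendsto_const_nhds this
  · have := isProbabilityMeasure_lawAt (kernel β J) ν
    exact tendsto_integral_of_monotone_local (hlim ν hν) f

/-! ## A recursive inequality that implies exponential decay -/

/-- Along n = 2^j n₀ the choice L = L₀ + j l balances the two terms: L^d grows only polynomially in
j, while r and x^L shrink geometrically. The rate q is small enough to beat n^d. -/
theorem exists_subseq_pow_mul_tendsto {r : ℕ → ℝ} (h0 : ∀ n, 0 ≤ r n)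
    (hlim : Tendsto r atTop (𝓝 0)) {D C x : ℝ} (hD : 0 < D) (hC : 0 < C) (hx : 0 < x)
    (hx1 : x < 1) {d : ℕ}
    (h : ∀ n L : ℕ, 2 ≤ L → r (2 * n) ≤ D * L ^ d * r n ^ 2 + C * x ^ L) :
    ∃ n₀ : ℕ, 2 ≤ n₀ ∧
      Tendsto (fun j : ℕ => ((2 ^ j * n₀ : ℕ) : ℝ) ^ d * r (2 ^ j * n₀)) atTop (𝓝 0) := by
  -- Chosen so that (2^j)^d q^j = 2^(-j).
  set q : ℝ := (1 / 2) ^ (d + 1) with hq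
  have hq0 : 0 < q := by positivity
  obtain ⟨l, hl⟩ : ∃ l : ℕ, x ^ l ≤ q := by
    obtain ⟨l, hl⟩ := exists_pow_lt_of_lt_one hq0 hx1
    exact ⟨l, hl.le⟩
  obtain ⟨L₀, hL2, hLl, hL⟩ : ∃ L₀ : ℕ, 2 ≤ L₀ ∧ l ≤ L₀ ∧
      (L₀ : ℝ) ^ d * x ^ L₀ ≤ q ^ 2 / (4 * D * C) := by
    have ht := tendsto_pow_const_mul_const_pow_of_abs_lt_one d
      (show |x| < 1 by rwa [abs_of_pos hx])
    have hpos : 0 < q ^ 2 / (4 * D * C) := by positivity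
    obtain ⟨L, hL⟩ := ((ht.eventually_lt_const hpos).and
      ((eventually_ge_atTop 2).and (eventually_ge_atTop l))).exists
    exact ⟨L, hL.2.1, hL.2.2, hL.1.le⟩
  have hL0 : (0 : ℝ) < (L₀ : ℝ) ^ d := by positivity
  -- The size of r to start from: the quadratic term then costs at most half of δ q, and L₀ is so
  -- large that the exponential term costs at most the other half.
  set δ : ℝ := q / (2 * D * (L₀ : ℝ) ^ d) with hδ
  have hδ0 : 0 < δ := by positivity
  have hδ1 : D * (L₀ : ℝ) ^ d * δ = q / 2 := by
    rw [hδ]; field_simp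
  have hδ2 : C * x ^ L₀ ≤ δ * q / 2 := by
    have e : δ * q / 2 = C * (q ^ 2 / (4 * D * C)) / (L₀ : ℝ) ^ d := by
      rw [hδ]; field_simp; ring
    rw [e, le_div_iff₀ hL0]
    calc C * x ^ L₀ * (L₀ : ℝ) ^ d = C * ((L₀ : ℝ) ^ d * x ^ L₀) := by ring
      _ ≤ _ := by gcongr
  obtain ⟨n₀, hn₀, hn₀2⟩ := ((hlim.eventually_lt_const hδ0).and (eventually_ge_atTop 2)).exists
  have hdecay : ∀ j : ℕ, r (2 ^ j * n₀) ≤ δ * q ^ j := by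
    intro j
    induction j with
    | zero => simpa using hn₀.le
    | succ j ih =>
      have h1 := h (2 ^ j * n₀) (L₀ + j * l) (by omega)
      rw [show 2 * (2 ^ j * n₀) = 2 ^ (j + 1) * n₀ by ring] at h1
      have hpq : (1 + (j : ℝ)) ^ d * q ^ j ≤ 1 := by
        have h2 : (1 + (j : ℝ)) ≤ 2 ^ j := by
          exact_mod_cast (by rw [add_comm]; exact Nat.lt_two_pow_self : 1 + j ≤ 2 ^ j)
        calc (1 + (j : ℝ)) ^ d * q ^ j ≤ (2 ^ j) ^ d * q ^ j := by gcongr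
          _ = (1 / 2) ^ j := by
              rw [hq, ← pow_mul, ← pow_mul, mul_comm j d, add_mul, pow_add, one_mul, ← mul_assoc,
                ← mul_pow]
              norm_num
          _ ≤ 1 := pow_le_one₀ (by norm_num) (by norm_num)
      have hLj : ((L₀ + j * l : ℕ) : ℝ) ≤ L₀ * (1 + j) := by
        have : (l : ℝ) ≤ L₀ := by exact_mod_cast hLl
        push_cast
        nlinarith [mul_le_mul_of_nonneg_left this (Nat.cast_nonneg (α := ℝ) j)]
      have hA : D * ((L₀ + j * l : ℕ) : ℝ) ^ d * r (2 ^ j * n₀) ^ 2 ≤ q / 2 * (δ * q ^ j) := by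
        calc D * ((L₀ + j * l : ℕ) : ℝ) ^ d * r (2 ^ j * n₀) ^ 2
            ≤ D * (L₀ * (1 + j)) ^ d * (δ * q ^ j) ^ 2 := by
              gcongr
              exact h0 _
          _ = D * (L₀ : ℝ) ^ d * δ * (δ * q ^ j) * ((1 + (j : ℝ)) ^ d * q ^ j) := by
              rw [mul_pow (L₀ : ℝ)]; ring
          _ ≤ D * (L₀ : ℝ) ^ d * δ * (δ * q ^ j) * 1 := by gcongr
          _ = _ := by rw [hδ1, mul_one]
      have hB : C * x ^ (L₀ + j * l) ≤ δ * q / 2 * q ^ j := by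
        calc C * x ^ (L₀ + j * l) = C * x ^ L₀ * (x ^ l) ^ j := by ring
          _ ≤ δ * q / 2 * q ^ j := by gcongr
      calc r (2 ^ (j + 1) * n₀) ≤ q / 2 * (δ * q ^ j) + δ * q / 2 * q ^ j := by linarith
        _ = _ := by ring
  refine ⟨n₀, hn₀2, ?_⟩
  have hlim2 : Tendsto (fun j : ℕ => (n₀ : ℝ) ^ d * δ * (1 / 2) ^ j) atTop (𝓝 0) := by
    simpa using (tendsto_pow_atTop_nhds_zero_of_lt_one (r := (1 / 2 : ℝ)) (by norm_num)
      (by norm_num)).const_mul ((n₀ : ℝ) ^ d * δ)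
  refine squeeze_zero (fun j => mul_nonneg (by positivity) (h0 _)) (fun j => ?_) hlim2
  calc ((2 ^ j * n₀ : ℕ) : ℝ) ^ d * r (2 ^ j * n₀)
      ≤ ((2 ^ j * n₀ : ℕ) : ℝ) ^ d * (δ * q ^ j) := by gcongr; exact hdecay j
    _ = (n₀ : ℝ) ^ d * δ * ((2 ^ j) ^ d * q ^ j) := by push_cast; ring
    _ = _ := by
        rw [hq, ← pow_mul, ← pow_mul, mul_comm j d, add_mul, pow_add, one_mul, ← mul_assoc (2 ^ _),
          ← mul_pow]
        norm_num

theorem le_exp_of_le_sq {u : ℕ → ℝ} (h0 : ∀ n, 0 ≤ u n)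
    (hsq : ∀ n, 2 ≤ n → u (2 * n) ≤ u n ^ 2) {N : ℕ} (hN : 2 ≤ N)
    (hu : u N ≤ Real.exp (-1)) (i : ℕ) :
    u (2 ^ i * N) ≤ Real.exp (-2 ^ i) := by
  induction i with
  | zero => simpa using hu
  | succ i ih =>
    have h2 : 2 ≤ 2 ^ i * N := hN.trans (Nat.le_mul_of_pos_left N (by positivity))
    calc u (2 ^ (i + 1) * N) = u (2 * (2 ^ i * N)) := by ring_nf
      _ ≤ u (2 ^ i * N) ^ 2 := hsq _ h2
      _ ≤ Real.exp (-2 ^ i) ^ 2 := pow_le_pow_left₀ (h0 _) ih 2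
      _ = _ := by rw [← Real.exp_nat_mul]; congr 1; push_cast; ring

/-- With L = n the recursion squares a suitable multiple of n^d (r(n) + exp(-Mn/2)) each time n
doubles. The preceding lemma brings this quantity below exp(-1) at some n; monotonicity of r fills
the gaps between doublings. -/
theorem exists_exp_decay {r : ℕ → ℝ} (h0 : ∀ n, 0 ≤ r n) (hanti : Antitone r)
    (hlim : Tendsto r atTop (𝓝 0)) {D C M : ℝ} (hD : 0 < D) (hC : 0 < C) (hM : 0 < M) {d : ℕ}
    (h : ∀ n L : ℕ, 2 ≤ L → r (2 * n) ≤ D * L ^ d * r n ^ 2 + C * Real.exp (-M * L)) :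
    ∃ lam : ℝ, 0 < lam ∧ ∃ n₁ : ℕ, ∀ n, n₁ ≤ n → r n ≤ Real.exp (-lam * n) := by
  -- Half the rate M, so that the error exp(-Mn) is the square of y^n.
  set y : ℝ := Real.exp (-(M / 2)) with hy
  have hy0 : 0 < y := Real.exp_pos _
  have hy1 : y < 1 := Real.exp_lt_one_iff.2 (by linarith)
  have hyx : ∀ L : ℕ, Real.exp (-M * L) = (y ^ L) ^ 2 := by
    intro L
    rw [hy, ← Real.exp_nat_mul, ← Real.exp_nat_mul]
    congr 1
    push_cast
    ring
  have h' : ∀ n L : ℕ, 2 ≤ L → r (2 * n) ≤ D * L ^ d * r n ^ 2 + C * (y ^ 2) ^ L := by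
    intro n L hL
    have := h n L hL
    rwa [hyx, ← pow_mul, mul_comm L 2, pow_mul] at this
  obtain ⟨n₀, hn₀, ht⟩ := exists_subseq_pow_mul_tendsto h0 hlim hD hC (by positivity : 0 < y ^ 2)
    (pow_lt_one₀ hy0.le hy1 (by norm_num)) h'
  set E : ℝ := D + C + 1 with hE
  -- The factor 2^d absorbs the passage from n^d to (2n)^d, and E the constants of the recursion, so
  -- that the squaring inequality has constant one.
  set u : ℕ → ℝ := fun n => 2 ^ d * E * ((n : ℝ) ^ d * (r n + y ^ n)) with hu
  have hu0 : ∀ n, 0 ≤ u n := fun n => by have := h0 n; positivity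
  have hsq : ∀ n, 2 ≤ n → u (2 * n) ≤ u n ^ 2 := by
    intro n hn
    have h1 := h' n n hn
    have hn1 : (1 : ℝ) ≤ (n : ℝ) ^ d := one_le_pow₀ (by exact_mod_cast (by omega : 1 ≤ n))
    have hrn := h0 n
    have hyn : 0 < y ^ n := by positivity
    have hs : r (2 * n) + y ^ (2 * n) ≤ E * (n : ℝ) ^ d * (r n + y ^ n) ^ 2 := by
      have e : (y ^ 2) ^ n = (y ^ n) ^ 2 := by ring
      have e' : y ^ (2 * n) = (y ^ n) ^ 2 := by ring
      rw [e] at h1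
      rw [e']
      have h2 : (C + 1) * (y ^ n) ^ 2 ≤ (C + 1) * (n : ℝ) ^ d * (y ^ n) ^ 2 := by
        have : (C + 1) * 1 ≤ (C + 1) * (n : ℝ) ^ d := by gcongr
        rw [mul_one] at this
        gcongr
      have h3 : D * (n : ℝ) ^ d * r n ^ 2 ≤ E * (n : ℝ) ^ d * r n ^ 2 := by
        gcongr; linarith
      have h4 : (C + 1) * (n : ℝ) ^ d * (y ^ n) ^ 2 ≤ E * (n : ℝ) ^ d * (y ^ n) ^ 2 := by
        gcongr; linarith
      have h5 : 0 ≤ E * (n : ℝ) ^ d * (2 * r n * y ^ n) := by positivity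
      linarith [show E * (n : ℝ) ^ d * (r n + y ^ n) ^ 2 = E * (n : ℝ) ^ d * r n ^ 2 +
        E * (n : ℝ) ^ d * (2 * r n * y ^ n) + E * (n : ℝ) ^ d * (y ^ n) ^ 2 by ring]
    calc u (2 * n) = 2 ^ d * E * ((2 * (n : ℝ)) ^ d * (r (2 * n) + y ^ (2 * n))) := by
          simp only [hu]; push_cast; ring
      _ ≤ 2 ^ d * E * ((2 * (n : ℝ)) ^ d * (E * (n : ℝ) ^ d * (r n + y ^ n) ^ 2)) := by gcongr
      _ = u n ^ 2 := by simp only [hu]; ring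
  have hsub : Tendsto (fun j : ℕ => 2 ^ j * n₀) atTop atTop :=
    tendsto_atTop_mono (fun j => (Nat.lt_two_pow_self (n := j)).le.trans
      (Nat.le_mul_of_pos_right _ (by omega))) tendsto_id
  have hty := (tendsto_pow_const_mul_const_pow_of_abs_lt_one d
    (show |y| < 1 by rwa [abs_of_pos hy0])).comp hsub
  have htu : Tendsto (fun j : ℕ => u (2 ^ j * n₀)) atTop (𝓝 0) := by
    have := (ht.add hty).const_mul (2 ^ d * E)
    simp only [add_zero, mul_zero] at this
    refine this.congr fun j => ?_
    simp only [hu, Function.comp]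
    ring
  obtain ⟨j, hj⟩ := (htu.eventually_lt_const (Real.exp_pos (-1))).exists
  set N := 2 ^ j * n₀ with hN
  have hN2 : 2 ≤ N := hn₀.trans (Nat.le_mul_of_pos_left _ (by positivity))
  have hN0 : (0 : ℝ) < N := by exact_mod_cast (by omega : 0 < N)
  have hru : ∀ n, 2 ≤ n → r n ≤ u n := by
    intro n hn
    have hn1 : (1 : ℝ) ≤ (n : ℝ) ^ d := one_le_pow₀ (by exact_mod_cast (by omega : 1 ≤ n))
    have h2 : (1 : ℝ) ≤ 2 ^ d := one_le_pow₀ (by norm_num)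
    have hyn : 0 < y ^ n := by positivity
    have h3 : (1 : ℝ) ≤ 2 ^ d * E * (n : ℝ) ^ d :=
      one_le_mul_of_one_le_of_one_le (one_le_mul_of_one_le_of_one_le h2 (by linarith)) hn1
    calc r n ≤ 1 * (r n + y ^ n) := by linarith
      _ ≤ 2 ^ d * E * (n : ℝ) ^ d * (r n + y ^ n) := by
          have := h0 n
          gcongr
      _ = u n := by simp only [hu]; ring
  -- With 2^i N ≤ n < 2^(i+1) N, the exponent 2^i exceeds n / (2N).
  refine ⟨1 / (2 * N), by positivity, N, fun n hn => ?_⟩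
  have hpos : n / N ≠ 0 := (Nat.div_pos hn (by omega)).ne'
  set i := Nat.log 2 (n / N) with hi
  have h1 : 2 ^ i * N ≤ n :=
    (Nat.mul_le_mul_right N (Nat.pow_log_le_self 2 hpos)).trans (Nat.div_mul_le_self n N)
  have h2 : n < 2 ^ (i + 1) * N :=
    (Nat.div_lt_iff_lt_mul (by omega)).1 (Nat.lt_pow_succ_log_self (by norm_num) _)
  have h2' : (n : ℝ) ≤ 2 ^ (i + 1) * N := by exact_mod_cast h2.le
  have h3 : 2 ≤ 2 ^ i * N := hN2.trans (Nat.le_mul_of_pos_left N (by positivity))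
  calc r n ≤ r (2 ^ i * N) := hanti h1
    _ ≤ u (2 ^ i * N) := hru _ h3
    _ ≤ Real.exp (-2 ^ i) := le_exp_of_le_sq hu0 hsq hN2 hj.le i
    _ ≤ _ := by
        rw [Real.exp_le_exp, neg_mul, neg_le_neg_iff, one_div, inv_mul_le_iff₀ (by positivity)]
        calc (n : ℝ) ≤ 2 ^ (i + 1) * N := h2'
          _ = _ := by ring

/-! ## Differences of expectations under stochastically ordered measures -/

/-- `μ` is stochastically smaller than `ν`. -/
def StochLE {d : ℕ} (μ ν : Measure (Config d)) : Prop :=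
  ∀ f : Config d → ℝ, Monotone f → IsLocal f → ∫ σ, f σ ∂μ ≤ ∫ σ, f σ ∂ν

theorem integral_sum_spin {d : ℕ} (Λ : Finset (Site d)) (c : Site d → ℝ) (μ : Measure (Config d))
    [IsProbabilityMeasure μ] :
    ∫ σ, ∑ k ∈ Λ, c k * spinVal (σ k) ∂μ = ∑ k ∈ Λ, c k * ∫ σ, spinVal (σ k) ∂μ := by
  rw [integral_finsetSum]
  · exact Finset.sum_congr rfl fun k _ => integral_const_mul _ _
  · exact fun k _ => ((isLocal_spinVal k).const_mul (c k)).integrable μ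

theorem isLocal_sum_spin {d : ℕ} (Λ : Finset (Site d)) (c : Site d → ℝ) :
    IsLocal fun σ : Config d => ∑ k ∈ Λ, c k * spinVal (σ k) :=
  isLocal_finset_sum Λ fun k _ => (isLocal_spinVal k).const_mul (c k)

/-- Stochastic order applied to the monotone difference: a linear combination of spins that
increases faster than f controls the increments of f. -/
theorem StochLE.integral_sub_le {d : ℕ} {μ ν : Measure (Config d)} [IsProbabilityMeasure μ]
    [IsProbabilityMeasure ν] (h : StochLE μ ν) {Λ : Finset (Site d)} {c : Site d → ℝ}
    {f : Config d → ℝ} (hl : IsLocal f)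
    (hm : Monotone fun σ => ∑ k ∈ Λ, c k * spinVal (σ k) - f σ) :
    ∫ σ, f σ ∂ν - ∫ σ, f σ ∂μ ≤
      ∑ k ∈ Λ, c k * (∫ σ, spinVal (σ k) ∂ν - ∫ σ, spinVal (σ k) ∂μ) := by
  have hs := isLocal_sum_spin Λ c
  have h1 := h _ hm (by simpa [sub_eq_add_neg] using hs.add (hl.const_mul (-1)))
  rw [integral_sub (hs.integrable μ) (hl.integrable μ),
    integral_sub (hs.integrable ν) (hl.integrable ν), integral_sum_spin, integral_sum_spin] at h1
  simp only [mul_sub, Finset.sum_sub_distrib]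
  linarith

theorem spin_eq_of_le_of_ne {s t : Spin} (h : s ≤ t) (hne : s ≠ t) : s = -1 ∧ t = 1 := by
  revert s t; decide

/-- If two ordered configurations differ on Λ, one differing spin already contributes b - a, the
largest possible increase of f; if they agree there, f does not change. -/
theorem monotone_sum_spin_sub {d : ℕ} {Λ : Finset (Site d)} {f : Config d → ℝ}
    (hf : DependsOn f (Λ : Set (Site d))) {a b : ℝ} (ha : ∀ σ, a ≤ f σ) (hb : ∀ σ, f σ ≤ b) :
    Monotone fun σ : Config d => ∑ k ∈ Λ, (b - a) / 2 * spinVal (σ k) - f σ := by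
  have hab : a ≤ b := (ha fun _ => 1).trans (hb _)
  intro σ η h
  have key : f η - f σ ≤ ∑ k ∈ Λ, (b - a) / 2 * (spinVal (η k) - spinVal (σ k)) := by
    have hnn : ∀ k ∈ Λ, 0 ≤ (b - a) / 2 * (spinVal (η k) - spinVal (σ k)) := fun k _ =>
      mul_nonneg (by linarith) (sub_nonneg.2 (spinVal_mono (h k)))
    by_cases hagree : ∀ k ∈ Λ, σ k = η k
    · rw [hf hagree, sub_self]
      exact Finset.sum_nonneg hnn
    · push Not at hagree
      obtain ⟨k, hk, hne⟩ := hagree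
      refine le_trans ?_ (Finset.single_le_sum hnn hk)
      obtain ⟨h1, h2⟩ := spin_eq_of_le_of_ne (h k) hne
      rw [h1, h2, spinVal_one, spinVal_neg_one]
      linarith [ha σ, hb η]
  simp only [mul_sub, Finset.sum_sub_distrib] at key
  simp only
  linarith

/-! ### Oscillations of local functions. -/

theorem oscAt_nonneg {d : ℕ} (f : Config d → ℝ) (k : Site d) : 0 ≤ oscAt f k :=
  Real.sSup_nonneg fun _ ⟨_, _, _, hx⟩ => hx ▸ abs_nonneg _

theorem abs_sub_le_oscAt {d : ℕ} {f : Config d → ℝ} (hf : IsLocal f) {k : Site d}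
    {σ η : Config d} (h : ∀ j, j ≠ k → σ j = η j) : |f σ - f η| ≤ oscAt f k := by
  obtain ⟨C, hC⟩ := hf.exists_bound
  refine le_csSup ⟨C + C, ?_⟩ ⟨σ, η, h, rfl⟩
  rintro _ ⟨σ, η, -, rfl⟩
  exact (abs_sub _ _).trans (add_le_add (hC _) (hC _))

theorem oscAt_eq_zero {d : ℕ} {Λ : Finset (Site d)} {f : Config d → ℝ}
    (hf : DependsOn f (Λ : Set (Site d))) {k : Site d} (hk : k ∉ Λ) : oscAt f k = 0 := by
  refine le_antisymm (Real.sSup_le ?_ le_rfl) (oscAt_nonneg f k)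
  rintro _ ⟨σ, η, h, rfl⟩
  rw [hf fun j hj => h j fun e => hk (e ▸ hj), sub_self, abs_zero]

theorem tripleNorm_eq_sum {d : ℕ} {Λ : Finset (Site d)} {f : Config d → ℝ}
    (hf : DependsOn f (Λ : Set (Site d))) : tripleNorm f = ∑ k ∈ Λ, oscAt f k :=
  tsum_eq_sum fun _ hk => oscAt_eq_zero hf hk

/-- The spins in A are raised one site at a time. A flip changes the spin by 2, hence the factor
1/2. -/
theorem abs_sub_le_sum_oscAt {d : ℕ} {f : Config d → ℝ} (hf : IsLocal f) {σ η : Config d}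
    (h : σ ≤ η) (A : Finset (Site d)) :
    |f (pin A σ η) - f σ| ≤ ∑ k ∈ A, oscAt f k / 2 * (spinVal (η k) - spinVal (σ k)) := by
  classical
  induction A using Finset.induction_on with
  | empty =>
    have : pin ∅ σ η = σ := funext fun k => pin_of_notMem _ _ (Finset.notMem_empty k)
    simp [this]
  | insert a A ha ih =>
    rw [Finset.sum_insert ha]
    refine (abs_sub_le _ (f (pin A σ η)) _).trans (add_le_add ?_ ih)
    have hoff : ∀ j, j ≠ a → pin (insert a A) σ η j = pin A σ η j := by
      intro j hj
      by_cases hA : j ∈ A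
      · rw [pin_of_mem _ _ hA, pin_of_mem _ _ (Finset.mem_insert_of_mem hA)]
      · rw [pin_of_notMem _ _ hA, pin_of_notMem _ _ fun h =>
          (Finset.mem_insert.1 h).elim hj hA]
    by_cases hne : σ a = η a
    · have : pin (insert a A) σ η = pin A σ η := by
        funext j
        by_cases hj : j = a
        · rw [hj, pin_of_notMem _ _ ha, pin_of_mem _ _ (Finset.mem_insert_self a A), hne]
        · exact hoff j hj
      rw [this, hne]
      simp
    · obtain ⟨h1, h2⟩ := spin_eq_of_le_of_ne (h a) hne
      rw [h1, h2, spinVal_one, spinVal_neg_one]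
      refine (abs_sub_le_oscAt hf hoff).trans (le_of_eq ?_)
      ring

theorem StochLE.abs_integral_sub_le {d : ℕ} {μ ν : Measure (Config d)} [IsProbabilityMeasure μ]
    [IsProbabilityMeasure ν] (h : StochLE μ ν) {Λ : Finset (Site d)} {f : Config d → ℝ}
    (hf : DependsOn f (Λ : Set (Site d))) :
    |∫ σ, f σ ∂μ - ∫ σ, f σ ∂ν| ≤
      ∑ k ∈ Λ, oscAt f k / 2 * (∫ σ, spinVal (σ k) ∂ν - ∫ σ, spinVal (σ k) ∂μ) := by
  have hl : IsLocal f := ⟨Λ, hf⟩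
  have key : ∀ σ η : Config d, σ ≤ η →
      |f η - f σ| ≤ ∑ k ∈ Λ, oscAt f k / 2 * (spinVal (η k) - spinVal (σ k)) := by
    intro σ η hση
    have := abs_sub_le_sum_oscAt hl hση Λ
    rwa [apply_pin hf] at this
  have h1 : Monotone fun σ => ∑ k ∈ Λ, oscAt f k / 2 * spinVal (σ k) - f σ := by
    intro σ η hση
    have := (abs_le.1 (key σ η hση)).2
    simp only [mul_sub, Finset.sum_sub_distrib] at this
    simp only
    linarith
  -- The same comparison for -f supplies the other half of the absolute value.
  have h2 : Monotone fun σ => ∑ k ∈ Λ, oscAt f k / 2 * spinVal (σ k) - -1 * f σ := by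
    intro σ η hση
    have := (abs_le.1 (key σ η hση)).1
    simp only [mul_sub, Finset.sum_sub_distrib] at this
    simp only
    linarith
  have e1 := h.integral_sub_le hl h1
  have e2 := h.integral_sub_le (hl.const_mul (-1)) h2
  rw [integral_const_mul, integral_const_mul] at e2
  rw [abs_le]
  constructor <;> linarith

/-! ## Decay of the discrepancy at the origin -/

theorem transfer_iterate_eq_integral {d : ℕ} (β : ℝ) (J : Interaction d) {f : Config d → ℝ}
    (hf : IsLocal f) (n : ℕ) (σ : Config d) :
    (transfer β J)^[n] f σ = ∫ ω, f ω ∂(lawAt (kernel β J) (Measure.dirac σ) n) := by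
  rw [integral_lawAt β J _ hf, integral_dirac]

/-- The difference of the expected spins at the origin at time `n`, for the dynamics started from
the two constant configurations. -/
def discrepancy {d : ℕ} (β : ℝ) (J : Interaction d) (n : ℕ) : ℝ :=
  (transfer β J)^[n] (fun σ => spinVal (σ 0)) (fun _ => 1) -
    (transfer β J)^[n] (fun σ => spinVal (σ 0)) fun _ => -1

theorem monotone_spin {d : ℕ} (k : Site d) : Monotone fun σ : Config d => spinVal (σ k) :=
  fun _ _ h => spinVal_mono (h k)

theorem transfer_iterate_shift {d : ℕ} (β : ℝ) (J : Interaction d) (a : Site d)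
    {f : Config d → ℝ} (hf : IsLocal f) (n : ℕ) (η : Config d) :
    (transfer β J)^[n] (fun σ => f (shift a σ)) η = (transfer β J)^[n] f (shift a η) := by
  induction n generalizing f with
  | zero => rfl
  | succ n ih =>
    rw [Function.iterate_succ_apply, Function.iterate_succ_apply, ← ih (hf.transfer β J)]
    exact congrArg (fun g => (transfer β J)^[n] g η)
      (funext fun σ => transfer_shift β J a hf.measurable σ)

/-- Dynamics and constant starts are translation invariant, so the discrepancy at the origin
controls every site. -/
theorem transfer_iterate_spin_const {d : ℕ} (β : ℝ) (J : Interaction d) (k : Site d) (n : ℕ)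
    (s : Spin) :
    (transfer β J)^[n] (fun σ => spinVal (σ k)) (fun _ => s) =
      (transfer β J)^[n] (fun σ => spinVal (σ 0)) fun _ => s := by
  have := transfer_iterate_shift β J k (isLocal_spinVal 0) n fun _ => s
  simp only [shift, zero_add] at this
  exact this

theorem discrepancy_nonneg {d : ℕ} {β : ℝ} (hβ : 0 < β) {J : Interaction d}
    (hJ : ∀ k, 0 ≤ J.K k) (n : ℕ) : 0 ≤ discrepancy β J n :=
  sub_nonneg.2 ((transfer_iterate_monotone_local hβ hJ (monotone_spin 0) (isLocal_spinVal 0) n).1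
    (minus_le _))

theorem transfer_const {d : ℕ} (β : ℝ) (J : Interaction d) (c : ℝ) (η : Config d) :
    transfer β J (fun _ => c) η = c := by
  simp [transfer]

/-- One more step averages the iterate, so its value at all plus cannot rise and its value at all
minus cannot fall. -/
theorem antitone_discrepancy {d : ℕ} {β : ℝ} (hβ : 0 < β) {J : Interaction d}
    (hJ : ∀ k, 0 ≤ J.K k) : Antitone (discrepancy β J) := by
  refine antitone_nat_of_succ_le fun n => ?_
  obtain ⟨hm, hl⟩ :=
    transfer_iterate_monotone_local hβ hJ (monotone_spin 0) (isLocal_spinVal 0) n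
  have h1 := transfer_le_transfer β J hl (isLocal_const _) (fun σ => hm (le_plus σ)) fun _ => 1
  have h2 := transfer_le_transfer β J (isLocal_const _) hl (fun σ => hm (minus_le σ)) fun _ => -1
  rw [transfer_const] at h1 h2
  simp only [discrepancy, Function.iterate_succ_apply']
  exact sub_le_sub h1 h2

theorem tendsto_discrepancy {d : ℕ} {β : ℝ} (hβ : 0 < β) {J : Interaction d}
    (hJ : ∀ k, 0 ≤ J.K k) (h : extremal β J (-1) = extremal β J 1) :
    Tendsto (discrepancy β J) atTop (𝓝 0) := by
  have h1 := tendsto_transfer_iterate_plus hβ hJ (monotone_spin 0) (isLocal_spinVal 0)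
  have h2 := tendsto_transfer_iterate_minus hβ hJ (monotone_spin 0) (isLocal_spinVal 0)
  rw [h] at h2
  have h3 := h1.sub h2
  rwa [sub_self] at h3

theorem stochLE_lawAt_plus {d : ℕ} {β : ℝ} (hβ : 0 < β) {J : Interaction d}
    (hJ : ∀ k, 0 ≤ J.K k) (ν : Measure (Config d)) [IsProbabilityMeasure ν] (n : ℕ) :
    StochLE (lawAt (kernel β J) ν n) (lawAt (kernel β J) (Measure.dirac fun _ => 1) n) := by
  intro f hf hl
  rw [← transfer_iterate_eq_integral β J hl, integral_lawAt β J ν hl]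
  exact integral_le_transfer_iterate_plus hβ hJ ν hf hl n

theorem stochLE_lawAt_minus {d : ℕ} {β : ℝ} (hβ : 0 < β) {J : Interaction d}
    (hJ : ∀ k, 0 ≤ J.K k) (ν : Measure (Config d)) [IsProbabilityMeasure ν] (n : ℕ) :
    StochLE (lawAt (kernel β J) (Measure.dirac fun _ => -1) n) (lawAt (kernel β J) ν n) := by
  intro f hf hl
  rw [← transfer_iterate_eq_integral β J hl, integral_lawAt β J ν hl]
  exact transfer_iterate_minus_le_integral hβ hJ ν hf hl n

theorem transfer_iterate_mono {d : ℕ} (β : ℝ) (J : Interaction d) {f g : Config d → ℝ}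
    (hf : IsLocal f) (hg : IsLocal g) (h : ∀ σ, f σ ≤ g σ) (n : ℕ) (η : Config d) :
    (transfer β J)^[n] f η ≤ (transfer β J)^[n] g η := by
  have := isProbabilityMeasure_lawAt (kernel β J) (Measure.dirac η) n
  rw [transfer_iterate_eq_integral β J hf, transfer_iterate_eq_integral β J hg]
  exact integral_mono (hf.integrable _) (hg.integrable _) h

/-- The recursive inequality for the discrepancy. -/
theorem discrepancy_add_le {d : ℕ} {β : ℝ} (hβ : 0 < β) {J : Interaction d}
    (hJ : ∀ k, 0 ≤ J.K k) {Λ : Finset (Site d)} (h0 : 0 ∈ Λ) (n m : ℕ) :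
    discrepancy β J (n + m) ≤ Λ.card * (discrepancy β J m / 2) * discrepancy β J n +
      (boxAvg β J 1 Λ (fun σ => spinVal (σ 0)) -
        boxAvg β J (-1) Λ fun σ => spinVal (σ 0)) := by
  set f₀ : Config d → ℝ := fun σ => spinVal (σ 0) with hf₀
  have hm₀ : Monotone f₀ := monotone_spin 0
  have hl₀ : IsLocal f₀ := isLocal_spinVal 0
  have hd₀ : DependsOn f₀ (Λ : Set (Site d)) := fun σ η h => congrArg spinVal (h 0 h0)
  obtain ⟨hgm, hgl⟩ := transfer_iterate_monotone_local hβ hJ hm₀ hl₀ m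
  set g := (transfer β J)^[m] f₀ with hg
  set a := g fun _ => -1 with ha
  set b := g fun _ => 1 with hb
  have hga : ∀ σ, a ≤ g σ := fun σ => hgm (minus_le σ)
  have hgb : ∀ σ, g σ ≤ b := fun σ => hgm (le_plus σ)
  have hdm : discrepancy β J m = b - a := rfl
  -- Bounds for g that see only Λ. The truncation at b, and at a in q, keeps their values in [a, b],
  -- so one flip changes them by at most the discrepancy at time m.
  set p : Config d → ℝ := fun σ => min ((boxTransfer β J 1 Λ)^[m] f₀ σ) b with hp
  set q : Config d → ℝ := fun σ => max ((boxTransfer β J (-1) Λ)^[m] f₀ σ) a with hq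
  have hgp : ∀ σ, g σ ≤ p σ := fun σ =>
    le_min (transfer_iterate_le_boxTransfer hβ hJ hd₀ hm₀ m σ) (hgb σ)
  have hqg : ∀ σ, q σ ≤ g σ := fun σ =>
    max_le (boxTransfer_le_transfer_iterate hβ hJ hd₀ hm₀ m σ) (hga σ)
  have hpd : DependsOn p (Λ : Set (Site d)) := fun σ η h =>
    congrArg (min · b) (dependsOn_boxTransfer_iterate β J 1 hd₀ m h)
  have hqd : DependsOn q (Λ : Set (Site d)) := fun σ η h =>
    congrArg (max · a) (dependsOn_boxTransfer_iterate β J (-1) hd₀ m h)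
  have hpl : IsLocal p := ⟨Λ, hpd⟩
  have hql : IsLocal q := ⟨Λ, hqd⟩
  have hpm : Monotone p := fun σ η h =>
    min_le_min_right b (boxTransfer_iterate_monotone hβ hJ 1 hd₀ hm₀ m h)
  have hqm : Monotone q := fun σ η h =>
    max_le_max_right a (boxTransfer_iterate_monotone hβ hJ (-1) hd₀ hm₀ m h)
  have hps := monotone_sum_spin_sub hpd (fun σ => (hga σ).trans (hgp σ))
    (b := b) fun σ => min_le_right _ _
  have hqs := monotone_sum_spin_sub hqd (a := a) (fun σ => le_max_right _ _)
    fun σ => (hqg σ).trans (hgb σ)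
  -- A reference measure that is both stationary and Gibbs. Its mean spins enter the two estimates
  -- with opposite signs and cancel.
  set μ := extremal β J 1
  have hinv : (kernel β J).Invariant μ := invariant_extremal β J 1
  have hgibbs := extremal_mem_gibbsMeasures β J 1
  have hP := isProbabilityMeasure_lawAt (kernel β J) (Measure.dirac fun _ : Site d => (1 : Spin)) n
  have hM := isProbabilityMeasure_lawAt (kernel β J)
    (Measure.dirac fun _ : Site d => (-1 : Spin)) n
  have hsP := stochLE_lawAt_plus hβ hJ μ n
  have hsM := stochLE_lawAt_minus hβ hJ μ n
  rw [lawAt_eq_self hinv] at hsP hsM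
  have e1 := hsP.integral_sub_le hpl hps
  have e2 := hsM.integral_sub_le hql hqs
  simp only [← transfer_iterate_eq_integral β J hpl, ← transfer_iterate_eq_integral β J hql,
    ← transfer_iterate_eq_integral β J (isLocal_spinVal _), transfer_iterate_spin_const,
    ← Finset.mul_sum, Finset.sum_sub_distrib, Finset.sum_const, nsmul_eq_mul] at e1 e2
  -- Under the box measure the truncation can be dropped, and invariance under the box dynamics
  -- removes the m steps.
  have i1 : ∫ σ, p σ ∂μ ≤ boxAvg β J 1 Λ f₀ := by
    refine (gibbs_le_boxAvg hβ hJ hgibbs Λ hpm hpl).2.trans ?_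
    rw [← boxAvg_boxTransfer_iterate β J 1 hd₀ m]
    exact blockAvg_mono (boxWeight_pos β J 1 Λ) fun ξ => min_le_left _ _
  have i2 : boxAvg β J (-1) Λ f₀ ≤ ∫ σ, q σ ∂μ := by
    refine le_trans ?_ (gibbs_le_boxAvg hβ hJ hgibbs Λ hqm hql).1
    rw [← boxAvg_boxTransfer_iterate β J (-1) hd₀ m]
    exact blockAvg_mono (boxWeight_pos β J (-1) Λ) fun ξ => le_max_left _ _
  have j1 := transfer_iterate_mono β J hgl hpl hgp n fun _ => 1
  have j2 := transfer_iterate_mono β J hql hgl hqg n fun _ => -1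
  rw [hg, ← Function.iterate_add_apply] at j1 j2
  rw [hdm]
  simp only [discrepancy]
  linarith

/-! ### Geometry of balls and the exponential rate. -/

theorem siteNorm_sub_le {d : ℕ} (k j : Site d) : siteNorm k ≤ siteNorm (k - j) + siteNorm j := by
  simp only [siteNorm, ← Finset.sum_add_distrib]
  refine Finset.sum_le_sum fun i _ => ?_
  rw [Pi.sub_apply]
  omega

theorem zero_mem_ball {d : ℕ} (L : ℕ) : (0 : Site d) ∈ ball d L :=
  mem_ball.2 (by simp [siteNorm])

theorem card_ball_le (d L : ℕ) : (ball d L).card ≤ (2 * L + 1) ^ d := by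
  have h : ball d L ⊆ Fintype.piFinset fun _ : Fin d => Finset.Icc (-(L : ℤ)) L := by
    intro k hk
    rw [Fintype.mem_piFinset]
    intro i
    have h1 : (k i).natAbs ≤ L :=
      (Finset.single_le_sum (f := fun i => (k i).natAbs) (fun _ _ => Nat.zero_le _)
        (Finset.mem_univ i)).trans (mem_ball.1 hk)
    rw [Finset.mem_Icc]
    omega
  refine (Finset.card_le_card h).trans (le_of_eq ?_)
  rw [Fintype.card_piFinset, Finset.prod_const, Finset.card_univ, Fintype.card_fin, Int.card_Icc]
  congr 1
  omega

theorem nbhdSet_ball_subset {d : ℕ} {J : Interaction d} {R : ℕ}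
    (hR : ∀ k, R < siteNorm k → J.K k = 0) (L : ℕ) : nbhdSet J (ball d L) ⊆ ball d (L + R) := by
  intro k hk
  obtain ⟨j, hj, hK⟩ := mem_nbhdSet.1 hk
  have h1 : siteNorm (k - j) ≤ R := by
    by_contra h
    exact hK (hR _ (not_le.1 h))
  have h2 := mem_ball.1 hj
  have h3 := siteNorm_sub_le k j
  exact mem_ball.2 (by omega)

/-- The reversible measures in a ball are dominated by the finite volume Gibbs measures in a
slightly smaller ball. -/
theorem boxAvg_sub_le {d : ℕ} {β : ℝ} (hβ : 0 < β) {J : Interaction d}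
    (hJ : ∀ k, 0 ≤ J.K k) {R : ℕ} (hR : ∀ k, R < siteNorm k → J.K k = 0) (L : ℕ)
    {f : Config d → ℝ} (hf : Monotone f) :
    boxAvg β J 1 (ball d (L + R)) f - boxAvg β J (-1) (ball d (L + R)) f ≤
      gibbsAvg β J (ball d L) f (fun _ => 1) - gibbsAvg β J (ball d L) f fun _ => -1 := by
  have h1 : ball d L ⊆ ball d (L + R) := ball_mono (Nat.le_add_right L R)
  have h2 := nbhdSet_ball_subset hR L
  have hmono := gibbsAvg_mono_boundary hβ hJ (ball d L) hf
  -- The extra radius R brings the inner ball with its neighbourhood inside the outer one, so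
  -- consistency applies; the inner boundary condition is then replaced by the extreme one.
  rw [← boxAvg_gibbsAvg β J 1 h1 h2, ← boxAvg_gibbsAvg β J (-1) h1 h2]
  refine sub_le_sub ?_ ?_
  · rw [← blockAvg_const (boxWeight_pos β J 1 (ball d (L + R)))
      (gibbsAvg β J (ball d L) f fun _ => 1) fun _ => 1]
    exact blockAvg_mono (boxWeight_pos β J 1 _) fun ξ => hmono (le_plus _)
  · rw [← blockAvg_const (boxWeight_pos β J (-1) (ball d (L + R)))
      (gibbsAvg β J (ball d L) f fun _ => -1) fun _ => -1]
    exact blockAvg_mono (boxWeight_pos β J (-1) _) fun ξ => hmono (minus_le _)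

theorem exists_discrepancy_exp_decay {d : ℕ} {β : ℝ} (hβ : 0 < β) {J : Interaction d}
    (hJ : ∀ k, 0 ≤ J.K k) (h : extremal β J (-1) = extremal β J 1)
    (hW : WeakMixing (potential β J)) :
    ∃ lam : ℝ, 0 < lam ∧ ∃ n₁ : ℕ, ∀ n, n₁ ≤ n → discrepancy β J n ≤ Real.exp (-lam * n) := by
  obtain ⟨C, hC, M, hM, hCM⟩ := hW
  obtain ⟨R, -, hR⟩ := J.finite_range
  have h0 := discrepancy_nonneg hβ hJ
  -- D comes from 2(L + R) + 1 ≤ (2R + 3) L, which bounds the side of a cube containing the ball of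
  -- radius L + R.
  refine exists_exp_decay (D := (2 * R + 3) ^ d) h0 (antitone_discrepancy hβ hJ)
    (tendsto_discrepancy hβ hJ h) (by positivity) hC hM (d := d) fun n L hL => ?_
  have h1 := discrepancy_add_le hβ hJ (zero_mem_ball (d := d) (L + R)) n n
  have h2 := boxAvg_sub_le hβ hJ hR L (monotone_spin 0)
  have h3 := hCM L hL
  rw [integral_finiteGibbs β J _ _ (isLocal_spinVal 0),
    integral_finiteGibbs β J _ _ (isLocal_spinVal 0)] at h3
  have hcard : ((ball d (L + R)).card : ℝ) ≤ (2 * R + 3) ^ d * (L : ℝ) ^ d := by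
    have h4 : (2 * (L + R) + 1) ≤ (2 * R + 3) * L := by nlinarith
    have h5 := (card_ball_le d (L + R)).trans (Nat.pow_le_pow_left h4 d)
    rw [mul_pow] at h5
    exact_mod_cast h5
  have h6 : (ball d (L + R)).card * (discrepancy β J n / 2) * discrepancy β J n ≤
      (2 * R + 3) ^ d * (L : ℝ) ^ d * discrepancy β J n ^ 2 := by
    have hD : (0 : ℝ) ≤ (2 * R + 3) ^ d * (L : ℝ) ^ d * discrepancy β J n ^ 2 := by positivity
    calc (ball d (L + R)).card * (discrepancy β J n / 2) * discrepancy β J n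
        = (ball d (L + R)).card * discrepancy β J n ^ 2 / 2 := by ring
      _ ≤ (2 * R + 3) ^ d * (L : ℝ) ^ d * discrepancy β J n ^ 2 / 2 := by gcongr
      _ ≤ _ := by linarith
  rw [two_mul n]
  linarith

theorem convergesExponentially_of_weakMixing {d : ℕ} {β : ℝ} (hβ : 0 < β) {J : Interaction d}
    (hJ : ∀ k, 0 ≤ J.K k) (h : extremal β J (-1) = extremal β J 1)
    (hW : WeakMixing (potential β J)) :
    ConvergesExponentially (kernel β J) (extremal β J 1) := by
  obtain ⟨lam, hlam, n₁, hn₁⟩ := exists_discrepancy_exp_decay hβ hJ h hW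
  refine ⟨lam, hlam, n₁, fun n hn f ⟨Λ, hΛ⟩ σ => ?_⟩
  -- Every law at time n is compared with the one started from all plus. Doing so for the given
  -- start and for the stationary measure accounts for the factor 2.
  have hbound : ∀ ν : Measure (Config d), IsProbabilityMeasure ν →
      |∫ ω, f ω ∂(lawAt (kernel β J) ν n) -
        ∫ ω, f ω ∂(lawAt (kernel β J) (Measure.dirac fun _ => 1) n)| ≤
      tripleNorm f * Real.exp (-lam * n) := by
    intro ν hν
    have hν' := isProbabilityMeasure_lawAt (kernel β J) ν n
    have hP := isProbabilityMeasure_lawAt (kernel β J)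
      (Measure.dirac fun _ : Site d => (1 : Spin)) n
    refine ((stochLE_lawAt_plus hβ hJ ν n).abs_integral_sub_le hΛ).trans ?_
    rw [tripleNorm_eq_sum hΛ, Finset.sum_mul]
    refine Finset.sum_le_sum fun k _ => ?_
    have hm := stochLE_lawAt_minus hβ hJ ν n _ (monotone_spin k) (isLocal_spinVal k)
    rw [← transfer_iterate_eq_integral β J (isLocal_spinVal k), transfer_iterate_spin_const] at hm
    rw [← transfer_iterate_eq_integral β J (isLocal_spinVal k), transfer_iterate_spin_const]
    have hd := hn₁ n hn
    have hd0 := discrepancy_nonneg hβ hJ n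
    rw [discrepancy] at hd hd0
    have ho := oscAt_nonneg f k
    have hp := stochLE_lawAt_plus hβ hJ ν n _ (monotone_spin k) (isLocal_spinVal k)
    rw [← transfer_iterate_eq_integral β J (isLocal_spinVal k), transfer_iterate_spin_const] at hp
    exact mul_le_mul (by linarith) (by linarith) (sub_nonneg.2 hp) ho
  have b1 := hbound (Measure.dirac σ) inferInstance
  have b2 := hbound (extremal β J 1) inferInstance
  rw [lawAt_eq_self (invariant_extremal β J 1), abs_sub_comm] at b2
  refine (abs_sub_le _ (∫ ω, f ω ∂(lawAt (kernel β J) (Measure.dirac fun _ => 1) n)) _).trans ?_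
  linarith

end

end PCA

theorem theorem2 (d : ℕ) (β : ℝ) (hβ : 0 < β) (J : PCA.Interaction d) (hJ : ∀ k, 0 ≤ J.K k) :
    (PCA.PhaseTransition (PCA.potential β J) → ¬ PCA.IsErgodic (PCA.kernel β J)) ∧
    (¬ PCA.PhaseTransition (PCA.potential β J) →
      ∃ μ : MeasureTheory.Measure (PCA.Config d),
        PCA.gibbsMeasures (PCA.potential β J) = {μ} ∧
        PCA.IsErgodicTowards (PCA.kernel β J) μ ∧
        (PCA.WeakMixing (PCA.potential β J) →
          PCA.ConvergesExponentially (PCA.kernel β J) μ)) := by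
  refine ⟨fun h he => PCA.not_phaseTransition_of_isErgodic hβ hJ he h, fun h => ?_⟩
  have h1 := PCA.gibbsMeasures_eq_singleton β J h 1
  have he : PCA.extremal β J (-1) = PCA.extremal β J 1 :=
    Set.singleton_injective ((PCA.gibbsMeasures_eq_singleton β J h (-1)).symm.trans h1)
  exact ⟨PCA.extremal β J 1, h1, PCA.isErgodicTowards_of_extremal_eq hβ hJ he,
    PCA.convergesExponentially_of_weakMixing hβ hJ he⟩
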